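/- A group $G$ is called an $\mathfrak X$-group if every non-cyclic subgroup $H$ of $G$ is self-centralizing, that is, satisfies $C_G(H)\le H$. For a prime $p$ let $\mathbb Z_{p^\infty}$ denote the Prüfer $p$-group. **Theorem.** Let $G$ be an infinite soluble group. Then $G$ is an $\mathfrak X$-group if and only if one of the following holds: 1. $G$ is cyclic; 2. $G\cong\mathbb Z_{p^\infty}$ for some prime $p$; 3. $G$ is isomorphic to the infinite dihedral group; 4. $G=A\langle y\rangle$ for some subgroup $A\cong\mathbb Z_{2^\infty}$ of $G$ and some $y\in G$ of order $2$ or $4$, with $y^2\in A$ and $y^{-1}ay=a^{-1}$ for all $a\in A$; 5. for some odd prime $p$, $G\cong \mathbb Z_{p^\infty}\rtimes D$, where $D$ is a non-trivial subgroup of a cyclic group $\langle\varphi\rangle\le\operatorname{Aut}(\mathbb Z_{p^\infty})$ generated by an automorphism $\varphi$ of order $p-1$, and $D$ acts naturally on $\mathbb Z_{p^\infty}$. -/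

import Mathlib

open scoped Pointwise

/-- `G` is an `𝔛`-group: every non-cyclic subgroup of `G` contains its centralizer in `G`. -/
def IsXGroup (G : Type*) [Group G] : Prop :=
  ∀ H : Subgroup G, ¬ IsCyclic H → Subgroup.centralizer (H : Set G) ≤ H

/-- The Prüfer `p`-group `ℤ_{p^∞}`, realized as the group of all complex roots of unity whose
order is a power of the prime `p`. -/
abbrev PruferGroup (p : ℕ) : Type :=
  CommGroup.primaryComponent ℂˣ p

/-! ### Prüfer groups: subgroups and divisibility. -/

namespace PruferGroup

/-! In an abelian `IsXGroup` every non-cyclic subgroup is the whole group. Applied to the image of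
the `p`-th power map, this makes an infinite non-cyclic one divisible; it is then torsion, and a
chain of successive `p`-th roots exhausts it, so it is a Prüfer group
(`IsXGroup.isCyclic_or_pruferGroup`).

An infinite soluble `IsXGroup` `G` has an infinite abelian normal subgroup `A`
(`IsXGroup.exists_infinite_normal_comm`), which is therefore infinite cyclic or Prüfer. If `A =
⟨a⟩`, the centralizer of `a` is abelian, hence infinite cyclic, and every element outside it inverts
its generator; `G` is cyclic or dihedral. If `A` is Prüfer, it is self-centralizing, so conjugation
embeds `G/A` in the automorphism group of `A`, with image consisting of elements of finite order.
Everything then rests on those automorphisms. A non-trivial one has vanishing norm, because `α - 1`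
is surjective. For odd `p` they form a cyclic group of order `p - 1` acting without non-trivial
fixed points, which makes `G` split over `A`; for `p = 2` only inversion occurs.

Conversely, in each family a non-cyclic subgroup is large enough to be checked directly: it contains
`A`, or it contains both a non-trivial element of the Prüfer (or rotation) part and an element
outside that part. -/

theorem exists_pow_eq_one {p : ℕ} (x : PruferGroup p) : ∃ k, x ^ p ^ k = 1 := by
  obtain ⟨x, k, hk⟩ := x
  exact ⟨k, Subtype.ext hk⟩

variable {p : ℕ} [hp : Fact p.Prime]

theorem exists_orderOf_eq (x : PruferGroup p) : ∃ k, orderOf x = p ^ k :=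
  exists_orderOf_eq_prime_pow_iff.2 (exists_pow_eq_one x)

theorem isOfFinOrder (x : PruferGroup p) : IsOfFinOrder x := by
  obtain ⟨k, hk⟩ := exists_pow_eq_one x
  exact isOfFinOrder_iff_pow_eq_one.2 ⟨_, pow_pos hp.out.pos k, hk⟩

theorem isOfFinOrder_of_mulEquiv {A : Type*} [Group A] (e : A ≃* PruferGroup p) (a : A) :
    IsOfFinOrder a :=
  (Function.Injective.isOfFinOrder_iff (f := e.toMonoidHom) e.injective).1 (isOfFinOrder (e a))

theorem mem_zpowers_of_pow_orderOf {x y : PruferGroup p} (h : y ^ orderOf x = 1) :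
    y ∈ Subgroup.zpowers x := by
  have : NeZero (orderOf x) := ⟨(isOfFinOrder x).orderOf_pos.ne'⟩
  have hx : IsPrimitiveRoot (x : ℂˣ) (orderOf x) := by
    rw [← Subgroup.orderOf_coe]
    exact IsPrimitiveRoot.orderOf _
  have hy : (y : ℂˣ) ∈ Subgroup.zpowers (x : ℂˣ) := by
    rw [hx.zpowers_eq, mem_rootsOfUnity]
    exact_mod_cast congrArg Subtype.val h
  obtain ⟨k, hk⟩ := hy
  exact ⟨k, Subtype.ext hk⟩

theorem mem_zpowers_total (x y : PruferGroup p) :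
    y ∈ Subgroup.zpowers x ∨ x ∈ Subgroup.zpowers y := by
  obtain ⟨m, hm⟩ := exists_orderOf_eq x
  obtain ⟨n, hn⟩ := exists_orderOf_eq y
  rcases le_total n m with h | h
  · left
    refine mem_zpowers_of_pow_orderOf (orderOf_dvd_iff_pow_eq_one.1 ?_)
    rw [hm, hn]; exact pow_dvd_pow _ h
  · right
    refine mem_zpowers_of_pow_orderOf (orderOf_dvd_iff_pow_eq_one.1 ?_)
    rw [hm, hn]; exact pow_dvd_pow _ h

theorem exists_pow_prime_eq (x : PruferGroup p) : ∃ y : PruferGroup p, y ^ p = x := by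
  obtain ⟨k, hk⟩ := exists_pow_eq_one x
  obtain ⟨z, hz⟩ := IsAlgClosed.exists_pow_nat_eq (((x : ℂˣ) : ℂ)) hp.out.pos
  have hz0 : z ≠ 0 := by
    rintro rfl
    rw [zero_pow hp.out.ne_zero] at hz
    exact (x : ℂˣ).ne_zero hz.symm
  have h1 : (Units.mk0 z hz0) ^ p = (x : ℂˣ) := Units.ext (by simpa using hz)
  refine ⟨⟨Units.mk0 z hz0, k + 1, ?_⟩, Subtype.ext h1⟩
  rw [pow_succ', pow_mul, h1]
  exact_mod_cast congrArg Subtype.val hk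

variable (p) in
theorem exists_orderOf_eq_prime : ∃ z : PruferGroup p, orderOf z = p := by
  have h : IsPrimitiveRoot (Complex.exp (2 * Real.pi * Complex.I / p)) p :=
    Complex.isPrimitiveRoot_exp p hp.out.ne_zero
  obtain ⟨u, hu⟩ := h.isUnit hp.out.ne_zero
  have h2 : IsPrimitiveRoot u p := by
    rw [← hu] at h
    exact IsPrimitiveRoot.coe_units_iff.1 h
  refine ⟨⟨u, 1, by simpa using h2.pow_eq_one⟩, ?_⟩
  rw [← Subgroup.orderOf_coe]
  exact h2.eq_orderOf.symm

/-- Cyclic subgroups are totally ordered, so a subgroup missing `y` lies inside `⟨y⟩`. -/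
theorem eq_top_of_not_isCyclic {H : Subgroup (PruferGroup p)} (hH : ¬ IsCyclic H) : H = ⊤ := by
  by_contra hne
  obtain ⟨y, hy⟩ : ∃ y, y ∉ H := by
    by_contra! h
    exact hne (eq_top_iff.2 fun x _ => h x)
  have hle : H ≤ Subgroup.zpowers y := by
    intro x hx
    rcases mem_zpowers_total x y with h | h
    · exact absurd ((Subgroup.zpowers_le.2 hx) h) hy
    · exact h
  exact hH (Subgroup.isCyclic_of_le hle)

end PruferGroup

/-! ### Recognizing Prüfer groups by chains of roots. -/

/-- A sequence `x 0, x 1, …` with `x 0` of order `p` and each term a `p`-th power of the next. -/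
structure IsPruferChain {G : Type*} [Group G] (p : ℕ) (x : ℕ → G) : Prop where
  pow_zero : x 0 ^ p = 1
  zero_ne_one : x 0 ≠ 1
  pow_succ : ∀ n, x (n + 1) ^ p = x n

namespace IsPruferChain

variable {G H : Type*} [Group G] [Group H] {p : ℕ} {x : ℕ → G}

theorem pow_pow (h : IsPruferChain p x) (m n : ℕ) : x (m + n) ^ p ^ n = x m := by
  induction n with
  | zero => simp
  | succ n ih => rw [_root_.pow_succ', pow_mul, ← add_assoc, h.pow_succ, ih]

theorem orderOf_eq [hp : Fact p.Prime] (h : IsPruferChain p x) (n : ℕ) : orderOf (x n) = p ^ (n + 1) := by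
  have h0 : x n ^ p ^ n = x 0 := by simpa using h.pow_pow 0 n
  apply orderOf_eq_prime_pow
  · rw [h0]; exact h.zero_ne_one
  · rw [_root_.pow_succ, pow_mul, h0, h.pow_zero]

theorem zpowers_mono (h : IsPruferChain p x) : Monotone fun n => Subgroup.zpowers (x n) := by
  refine monotone_nat_of_le_succ fun n => Subgroup.zpowers_le.2 ⟨p, ?_⟩
  simp [← h.pow_succ n]

theorem prodMk (h : IsPruferChain p x) {y : ℕ → H} (h' : IsPruferChain p y) :
    IsPruferChain p fun n => (x n, y n) where
  pow_zero := Prod.ext h.pow_zero h'.pow_zero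
  zero_ne_one := fun e => h.zero_ne_one (Prod.ext_iff.1 e).1
  pow_succ n := Prod.ext (h.pow_succ n) (h'.pow_succ n)

theorem mem_iSup_iff (h : IsPruferChain p x) {g : G} :
    g ∈ (⨆ n, Subgroup.zpowers (x n)) ↔ ∃ n, g ∈ Subgroup.zpowers (x n) :=
  Subgroup.mem_iSup_of_directed h.zpowers_mono.directed_le

theorem bijective_of_map [hp : Fact p.Prime] (h : IsPruferChain p x) {y : ℕ → H} (h' : IsPruferChain p y)
    (hy : ∀ g, ∃ n, g ∈ Subgroup.zpowers (y n)) (f : G →* H) (hf : ∀ n, f (x n) = y n) :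
    Function.Bijective (f.comp (⨆ n, Subgroup.zpowers (x n)).subtype) := by
  constructor
  · rw [injective_iff_map_eq_one]
    rintro ⟨g, hg⟩ h1
    obtain ⟨n, k, rfl⟩ := h.mem_iSup_iff.1 hg
    have h2 : y n ^ k = 1 := by simpa [hf] using h1
    rw [← orderOf_dvd_iff_zpow_eq_one, h'.orderOf_eq, ← h.orderOf_eq,
      orderOf_dvd_iff_zpow_eq_one] at h2
    exact Subtype.ext h2
  · intro g
    obtain ⟨n, k, rfl⟩ := hy g
    exact ⟨⟨x n ^ k, h.mem_iSup_iff.2 ⟨n, k, rfl⟩⟩, by simp [hf]⟩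

/-- The pairs `(x n, y n)` form a chain in `G × H`. The union of the cyclic groups they generate is
the graph of the isomorphism: both projections are bijective on it. -/
theorem nonempty_mulEquiv [hp : Fact p.Prime] (h : IsPruferChain p x) {y : ℕ → H} (h' : IsPruferChain p y)
    (hx : ∀ g, ∃ n, g ∈ Subgroup.zpowers (x n)) (hy : ∀ g, ∃ n, g ∈ Subgroup.zpowers (y n)) :
    Nonempty (G ≃* H) :=
  ⟨(MulEquiv.ofBijective _ ((h.prodMk h').bijective_of_map h hx (MonoidHom.fst G H)
      fun _ => rfl)).symm.trans
    (MulEquiv.ofBijective _ ((h.prodMk h').bijective_of_map h' hy (MonoidHom.snd G H)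
      fun _ => rfl))⟩

theorem not_isCyclic [hp : Fact p.Prime] (h : IsPruferChain p x) : ¬ IsCyclic ↥(⨆ n, Subgroup.zpowers (x n)) := by
  rw [Subgroup.isCyclic_iff_exists_zpowers_eq_top]
  rintro ⟨g, hg⟩
  have hg' : g ∈ (⨆ n, Subgroup.zpowers (x n)) := hg ▸ Subgroup.mem_zpowers g
  obtain ⟨n, hn⟩ := h.mem_iSup_iff.1 hg'
  have h1 : x (n + 1) ∈ Subgroup.zpowers (x n) := by
    have h2 : x (n + 1) ∈ Subgroup.zpowers g :=
      hg ▸ h.mem_iSup_iff.2 ⟨n + 1, Subgroup.mem_zpowers _⟩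
    exact (Subgroup.zpowers_le.2 hn) h2
  have h3 := orderOf_dvd_of_mem_zpowers h1
  rw [h.orderOf_eq, h.orderOf_eq, Nat.pow_dvd_pow_iff_le_right hp.out.one_lt] at h3
  omega

end IsPruferChain

/-- A sequence of successive preimages under a surjection. -/
theorem exists_seq_of_surjective {α : Type*} {f : α → α} (hf : Function.Surjective f) (a : α) :
    ∃ x : ℕ → α, x 0 = a ∧ ∀ n, f (x (n + 1)) = x n :=
  ⟨fun n => (Function.surjInv hf)^[n] a, rfl, fun n => by
    simp only [Function.iterate_succ', Function.comp]
    exact Function.surjInv_eq hf _⟩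

theorem exists_isPruferChain {G : Type*} [Group G] {p : ℕ} (hdiv : ∀ g : G, ∃ h : G, h ^ p = g)
    {z : G} (hz : z ^ p = 1) (hz1 : z ≠ 1) : ∃ x : ℕ → G, IsPruferChain p x := by
  obtain ⟨x, h0, h1⟩ := exists_seq_of_surjective (f := fun g : G => g ^ p) hdiv z
  exact ⟨x, h0 ▸ hz, h0 ▸ hz1, h1⟩

namespace PruferGroup

variable (p : ℕ) [hp : Fact p.Prime]

theorem exists_chain : ∃ x : ℕ → PruferGroup p, IsPruferChain p x := by
  obtain ⟨z, hz⟩ := exists_orderOf_eq_prime p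
  refine exists_isPruferChain exists_pow_prime_eq (z := z) (orderOf_dvd_iff_pow_eq_one.1 hz.dvd) ?_
  rintro rfl
  rw [orderOf_one] at hz
  exact hp.out.ne_one hz.symm

variable {p} in
theorem _root_.IsPruferChain.exists_mem_zpowers {x : ℕ → PruferGroup p} (h : IsPruferChain p x)
    (g : PruferGroup p) : ∃ n, g ∈ Subgroup.zpowers (x n) := by
  obtain ⟨n, hn⟩ := exists_pow_eq_one g
  refine ⟨n, mem_zpowers_of_pow_orderOf ?_⟩
  rw [h.orderOf_eq, pow_succ, pow_mul, hn, one_pow]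

theorem not_isCyclic : ¬ IsCyclic (PruferGroup p) := by
  intro hc
  obtain ⟨x, hx⟩ := exists_chain p
  exact hx.not_isCyclic inferInstance

end PruferGroup

theorem IsPruferChain.nonempty_mulEquiv_pruferGroup {G : Type*} [Group G] {p : ℕ}
    [hp : Fact p.Prime] {x : ℕ → G} (h : IsPruferChain p x)
    (hx : ∀ g, ∃ n, g ∈ Subgroup.zpowers (x n)) : Nonempty (G ≃* PruferGroup p) := by
  obtain ⟨y, hy⟩ := PruferGroup.exists_chain p
  exact h.nonempty_mulEquiv hy hx hy.exists_mem_zpowers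

/-! ### Endomorphisms and finite-order automorphisms of Prüfer groups. -/

namespace PruferGroup

variable {p : ℕ} [hp : Fact p.Prime]

theorem map_mem_zpowers (f : PruferGroup p →* PruferGroup p) (x : PruferGroup p) :
    f x ∈ Subgroup.zpowers x :=
  mem_zpowers_of_pow_orderOf (by rw [← map_pow, pow_orderOf_eq_one, map_one])

theorem mulAut_mul_comm (α β : MulAut (PruferGroup p)) : α * β = β * α := by
  ext1 x
  obtain ⟨m, hm⟩ := map_mem_zpowers α.toMonoidHom x
  obtain ⟨n, hn⟩ := map_mem_zpowers β.toMonoidHom x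
  change x ^ m = α x at hm
  change x ^ n = β x at hn
  rw [MulAut.mul_apply, MulAut.mul_apply, ← hm, ← hn, map_zpow, map_zpow, ← hm, ← hn,
    zpow_comm]

/-- The image is divisible by `p`. Were it proper, it would be cyclic with a generator `g` of
`p`-power order that is a `p`-th power in `⟨g⟩`, forcing `g = 1`. -/
theorem surjective_of_ne_one {f : PruferGroup p →* PruferGroup p} (hf : f ≠ 1) :
    Function.Surjective f := by
  rw [← MonoidHom.range_eq_top]
  refine eq_top_of_not_isCyclic fun hc => hf ?_
  obtain ⟨g, hg⟩ := (Subgroup.isCyclic_iff_exists_zpowers_eq_top _).1 hc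
  have hg' : g ∈ f.range := hg ▸ Subgroup.mem_zpowers g
  obtain ⟨a, ha⟩ := hg'
  obtain ⟨b, hb⟩ := exists_pow_prime_eq a
  have hfb : f b ∈ Subgroup.zpowers g := hg ▸ ⟨b, rfl⟩
  obtain ⟨j, hj⟩ := hfb
  have h1 : g ^ (j * p - 1) = 1 := by
    simp only at hj
    rw [zpow_sub, zpow_mul, hj, zpow_natCast, ← map_pow, hb, ha, zpow_one, mul_inv_cancel]
  obtain ⟨k, hk⟩ := exists_orderOf_eq g
  have hg1 : g = 1 := by
    rcases Nat.eq_zero_or_pos k with rfl | hk0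
    · rwa [pow_zero, orderOf_eq_one_iff] at hk
    · exfalso
      have h2 := orderOf_dvd_iff_zpow_eq_one.2 h1
      have h3 : (p : ℤ) ∣ j * p - 1 := dvd_trans (by
        rw [hk]; exact_mod_cast dvd_pow_self p hk0.ne') h2
      have h4 : (p : ℤ) ∣ 1 := by
        have := (dvd_sub_right (Dvd.intro_left j rfl : (p : ℤ) ∣ j * p)).1 h3
        exact this
      exact hp.out.one_lt.ne' (by exact_mod_cast Int.eq_one_of_dvd_one (by positivity) h4)
  ext1 x
  have : f x ∈ Subgroup.zpowers g := hg ▸ ⟨x, rfl⟩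
  rw [hg1, Subgroup.zpowers_one_eq_bot, Subgroup.mem_bot] at this
  simpa using this

/-- The norm of a non-trivial automorphism of finite order of a Prüfer group vanishes. -/
theorem prod_pow_apply_eq_one {α : MulAut (PruferGroup p)} (hα : α ≠ 1) {n : ℕ} (hn : α ^ n = 1)
    (a : PruferGroup p) : ∏ i ∈ Finset.range n, (α ^ i) a = 1 := by
  -- The endomorphism `α - 1` is non-trivial, hence surjective; on its image the norm telescopes.
  have hne : α.toMonoidHom / MonoidHom.id _ ≠ 1 := by
    intro h
    apply hα
    ext1 x
    have := DFunLike.congr_fun h x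
    simpa [div_eq_one] using this
  obtain ⟨b, rfl⟩ := surjective_of_ne_one hne a
  have : ∀ i, (α ^ i) ((α.toMonoidHom / MonoidHom.id (PruferGroup p) :
      PruferGroup p →* PruferGroup p) b) = (α ^ (i + 1)) b / (α ^ i) b := by
    intro i
    rw [pow_succ, MulAut.mul_apply, ← map_div]
    rfl
  simp only [this]
  rw [Finset.prod_range_div (fun i => (α ^ i) b), hn]
  simp

/-- If `α ≠ 1`, its norm at a fixed `z` of order `p` is `z ^ orderOf α`, so `p` divides the order
and some power `β` has order `p`. With `b ^ p = z` and `w = β b / b`, the norm of `β` at `b` is `z *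
w ^ (p(p-1)/2)`. The second factor is trivial, so `z = 1`, a contradiction. -/
theorem eq_one_of_fix_torsion {α : MulAut (PruferGroup p)} (hα : IsOfFinOrder α)
    (h1 : ∀ x, x ^ p = 1 → α x = x) (h2 : p = 2 → ∀ x, x ^ 4 = 1 → α x = x) : α = 1 := by
  by_contra hne
  obtain ⟨z, hz⟩ := exists_orderOf_eq_prime p
  have hzp : z ^ p = 1 := orderOf_dvd_iff_pow_eq_one.1 hz.dvd
  have hfix : ∀ x, α x = x → ∀ i : ℕ, (α ^ i) x = x := by
    intro x hx i
    induction i with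
    | zero => rfl
    | succ i ih => rw [pow_succ, MulAut.mul_apply, hx, ih]
  have hdvd : p ∣ orderOf α := by
    have := prod_pow_apply_eq_one hne (pow_orderOf_eq_one α) z
    simp only [hfix z (h1 z hzp), Finset.prod_const, Finset.card_range] at this
    exact hz.symm.dvd.trans (orderOf_dvd_of_pow_eq_one this)
  obtain ⟨m, hm⟩ := hdvd
  have hmpos : 0 < m := by
    have := hα.orderOf_pos
    rw [hm] at this
    exact Nat.pos_of_mul_pos_left this
  set β := α ^ m with hβ
  have hβp : β ^ p = 1 := by rw [hβ, ← pow_mul, mul_comm, ← hm, pow_orderOf_eq_one]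
  have hβ1 : β ≠ 1 := by
    intro h
    have := Nat.le_of_dvd hmpos (orderOf_dvd_of_pow_eq_one h)
    rw [hm] at this
    nlinarith [hp.out.two_le]
  obtain ⟨b, hb⟩ := exists_pow_prime_eq z
  set w := β b / b with hw
  have hwp : w ^ p = 1 := by
    rw [hw, div_pow, ← map_pow, hb, hfix z (h1 z hzp), div_self']
  have hβw : β w = w := hfix w (h1 w hwp) m
  have hβb : ∀ i : ℕ, (β ^ i) b = b * w ^ i := by
    intro i
    induction i with
    | zero => simp
    | succ i ih =>
      rw [pow_succ', MulAut.mul_apply, ih, map_mul, map_pow, hβw, pow_succ',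
        show β b = b * w by rw [hw, mul_div_cancel], mul_assoc]
  have hN := prod_pow_apply_eq_one hβ1 hβp b
  simp only [hβb, Finset.prod_mul_distrib, Finset.prod_const, Finset.card_range] at hN
  -- For odd `p` the exponent is a multiple of `p`. For `p = 2` it is `1`, and `w = 1` because `b ^
  -- 4 = 1`.
  have hws : w ^ (∑ i ∈ Finset.range p, i) = 1 := by
    rcases hp.out.eq_two_or_odd' with h | h
    · have : w = 1 := by
        rw [hw, div_eq_one]
        refine hfix b (h2 h b ?_) m
        subst h
        rw [show 4 = 2 * 2 from rfl, pow_mul, hb, hzp]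
      rw [this, one_pow]
    · obtain ⟨k, hk⟩ := h
      have : ∑ i ∈ Finset.range p, i = p * k := by
        rw [Finset.sum_range_id, show p - 1 = k * 2 by omega, ← mul_assoc,
          Nat.mul_div_cancel _ two_pos]
      rw [this, pow_mul, hwp, one_pow]
  rw [Finset.prod_pow_eq_pow_sum (Finset.range p) (fun i => i) w, hws, mul_one, hb] at hN
  rw [hN, orderOf_one] at hz
  exact hp.out.one_lt.ne hz

/-- Modulo `p ^ m`, the sequence `r ^ p ^ n` is constant from `n = m` on. A common exponent can thus
serve several elements at once. -/
theorem pow_pow_eq_pow_pow_orderOf (r : ℕ) {n : ℕ} {a : PruferGroup p} (ha : a ^ p ^ n = 1) :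
    a ^ r ^ p ^ n = a ^ r ^ orderOf a := by
  obtain ⟨m, hm⟩ := exists_orderOf_eq a
  have hmn : m ≤ n := by
    rw [← orderOf_dvd_iff_pow_eq_one, hm] at ha
    exact (Nat.pow_dvd_pow_iff_le_right hp.out.one_lt).1 ha
  rw [pow_eq_pow_iff_modEq, hm]
  clear ha hm
  induction n, hmn using Nat.le_induction with
  | base => rfl
  | succ k hk ih =>
    refine Nat.ModEq.trans ?_ ih
    have h1 : ((p : ℕ) : ℤ) ∣ (r : ℤ) ^ p - r := by
      rw [← ZMod.intCast_zmod_eq_zero_iff_dvd _ p]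
      push_cast
      rw [ZMod.pow_card, sub_self]
    have h2 := dvd_sub_pow_of_dvd_sub h1 k
    rw [Nat.modEq_iff_dvd, dvd_sub_comm]
    push_cast
    rw [pow_succ', pow_mul]
    exact dvd_trans (pow_dvd_pow _ (by omega)) h2

variable (p) in
/-- The endomorphism raising an element of order `p ^ n` to the power `r ^ p ^ n`, i.e. acting as
the Teichmüller representative of `r`. -/
noncomputable def teichmuller (r : ℕ) : PruferGroup p →* PruferGroup p where
  toFun a := a ^ r ^ orderOf a
  map_one' := one_pow _
  map_mul' a b := by
    obtain ⟨m, hm⟩ := exists_pow_eq_one a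
    obtain ⟨n, hn⟩ := exists_pow_eq_one b
    have ha : a ^ p ^ (m + n) = 1 := by rw [pow_add, pow_mul, hm, one_pow]
    have hb : b ^ p ^ (m + n) = 1 := by rw [pow_add, mul_comm, pow_mul, hn, one_pow]
    rw [← pow_pow_eq_pow_pow_orderOf r ha, ← pow_pow_eq_pow_pow_orderOf r hb,
      ← pow_pow_eq_pow_pow_orderOf r (n := m + n) (by rw [mul_pow, ha, hb, one_mul]), mul_pow]

theorem teichmuller_apply (r : ℕ) (a : PruferGroup p) :
    teichmuller p r a = a ^ r ^ orderOf a := rfl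

theorem teichmuller_injective {r : ℕ} (hr : r.Coprime p) :
    Function.Injective (teichmuller p r) := by
  rw [injective_iff_map_eq_one]
  intro a ha
  rw [teichmuller_apply, ← orderOf_dvd_iff_pow_eq_one] at ha
  obtain ⟨k, hk⟩ := exists_orderOf_eq a
  rw [← orderOf_eq_one_iff]
  refine Nat.Coprime.eq_one_of_dvd ?_ ha
  rw [hk]
  exact (hr.symm.pow _ _)

theorem teichmuller_bijective {r : ℕ} (hr : r.Coprime p) :
    Function.Bijective (teichmuller p r) := by
  refine ⟨teichmuller_injective hr, surjective_of_ne_one fun h => ?_⟩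
  obtain ⟨z, hz⟩ := exists_orderOf_eq_prime p
  have : z = 1 := teichmuller_injective hr (by rw [h]; rfl)
  rw [this, orderOf_one] at hz
  exact hp.out.one_lt.ne hz

variable (p) in
/-- The Teichmüller automorphisms of a Prüfer group form a cyclic group of order `p - 1` that
contains, for odd `p`, every automorphism of finite order. -/
theorem exists_mulAut_orderOf_eq : ∃ φ : MulAut (PruferGroup p), orderOf φ = p - 1 ∧
    (Odd p → ∀ α : MulAut (PruferGroup p), IsOfFinOrder α → α ∈ Subgroup.zpowers φ) := by
  -- `φ` is the Teichmüller lift of a generator of the units mod `p`; its order is read off from an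
  -- element `z` of order `p`.
  obtain ⟨g, hg⟩ := IsCyclic.exists_generator (α := (ZMod p)ˣ)
  set r : ℕ := (g : ZMod p).val with hr
  have hrg : (r : ZMod p) = g := by rw [hr, ZMod.natCast_zmod_val]
  have hrc : r.Coprime p := by rw [← ZMod.isUnit_iff_coprime, hrg]; exact g.isUnit
  have hgo : orderOf g = p - 1 := by
    rw [orderOf_eq_card_of_forall_mem_zpowers hg, Nat.card_eq_fintype_card, ZMod.card_units]
  let φ : MulAut (PruferGroup p) := MulEquiv.ofBijective _ (teichmuller_bijective hrc)
  have hφ : ∀ a, φ a = a ^ r ^ orderOf a := fun a => rfl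
  have hφi : ∀ (i : ℕ) a, (φ ^ i) a = a ^ (r ^ orderOf a) ^ i := by
    intro i a
    induction i with
    | zero => simp
    | succ i ih => rw [pow_succ', MulAut.mul_apply, ih, map_pow, hφ, ← pow_mul, pow_succ']
  have hφo : φ ^ (p - 1) = 1 := by
    ext1 a
    obtain ⟨k, hk⟩ := exists_orderOf_eq a
    rw [hφi, MulAut.one_apply]
    conv_rhs => rw [← pow_one a]
    rw [pow_eq_pow_iff_modEq, hk, ← pow_mul, mul_comm, pow_mul]
    have h1 : ((p : ℕ) : ℤ) ∣ (r : ℤ) ^ (p - 1) - 1 := by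
      rw [← ZMod.intCast_zmod_eq_zero_iff_dvd _ p]
      push_cast
      rw [hrg, ← Units.val_pow_eq_pow_val, ← hgo, pow_orderOf_eq_one, Units.val_one, sub_self]
    have h2 := dvd_sub_pow_of_dvd_sub h1 k
    rw [Nat.modEq_iff_dvd, dvd_sub_comm]
    push_cast
    rw [one_pow] at h2
    exact dvd_trans (pow_dvd_pow _ (by omega)) h2
  obtain ⟨z, hz⟩ := exists_orderOf_eq_prime p
  have hφz : ∀ (i : ℕ), (φ ^ i) z = z ^ r ^ i := by
    intro i
    rw [hφi, pow_eq_pow_iff_modEq, hz, ← ZMod.natCast_eq_natCast_iff]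
    push_cast
    rw [ZMod.pow_card]
  refine ⟨φ, Nat.dvd_antisymm (orderOf_dvd_of_pow_eq_one hφo) ?_, fun hodd α hα => ?_⟩
  · rw [← hgo]
    apply orderOf_dvd_of_pow_eq_one
    have h := hφz (orderOf φ)
    rw [pow_orderOf_eq_one, MulAut.one_apply] at h
    conv_lhs at h => rw [← pow_one z]
    rw [pow_eq_pow_iff_modEq, hz, ← ZMod.natCast_eq_natCast_iff] at h
    ext
    push_cast at h ⊢
    rw [← hrg, ← h]
  · obtain ⟨k, hk⟩ : ∃ k : ℕ, z ^ k = α z :=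
      (isOfFinOrder z).mem_powers_iff_mem_zpowers.2 (map_mem_zpowers α.toMonoidHom z)
    have hkc : k.Coprime p := by
      rw [Nat.coprime_comm, hp.out.coprime_iff_not_dvd, ← hz, orderOf_dvd_iff_pow_eq_one, hk]
      intro h
      have : z = 1 := α.injective (by rw [h, map_one])
      rw [this, orderOf_one] at hz
      exact hp.out.one_lt.ne hz
    obtain ⟨i, hi⟩ : ∃ i : ℕ, g ^ i = ZMod.unitOfCoprime k hkc :=
      (isOfFinOrder_of_finite g).mem_powers_iff_mem_zpowers.2 (hg _)
    have hi' : (φ ^ i) z = α z := by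
      rw [hφz, ← hk, pow_eq_pow_iff_modEq, hz, ← ZMod.natCast_eq_natCast_iff]
      push_cast
      rw [hrg, ← Units.val_pow_eq_pow_val, hi, ZMod.coe_unitOfCoprime]
    have hφfin : IsOfFinOrder (φ ^ i)⁻¹ := (IsOfFinOrder.pow
      (isOfFinOrder_iff_pow_eq_one.2 ⟨p - 1, by have := hp.out.two_le; omega, hφo⟩)).inv
    -- `α` and `φ ^ i` agree on `z`, hence on all elements of order `p`, and they commute.
    have h1 : (φ ^ i)⁻¹ * α = 1 := by
      refine eq_one_of_fix_torsion (Commute.isOfFinOrder_mul (mulAut_mul_comm _ _) hφfin hα)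
        (fun x hx => ?_) fun h => absurd hodd (by rw [h]; decide)
      obtain ⟨j, rfl⟩ : x ∈ Subgroup.zpowers z :=
        mem_zpowers_of_pow_orderOf (by rw [hz, hx])
      simp only [map_zpow]
      rw [MulAut.mul_apply, ← hi', MulAut.inv_apply_self]
    rw [inv_mul_eq_one] at h1
    exact h1 ▸ Subgroup.npow_mem_zpowers φ i

end PruferGroup

/-! ### Inheritance, and abelian 𝔛-groups. -/

theorem IsXGroup.subgroup {G : Type*} [Group G] (h : IsXGroup G) (K : Subgroup G) :
    IsXGroup K := by
  intro H hH x hx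
  have h1 : ¬ IsCyclic (H.map K.subtype) := fun hc =>
    hH ((H.equivMapOfInjective K.subtype K.subtype_injective).isCyclic.2 hc)
  have h2 : (x : G) ∈ H.map K.subtype := by
    refine h _ h1 ?_
    rw [Subgroup.mem_centralizer_iff] at hx ⊢
    rintro _ ⟨y, hy, rfl⟩
    exact congrArg Subtype.val (hx y hy)
  obtain ⟨y, hy, hyx⟩ := h2
  rwa [Subtype.ext hyx] at hy

theorem IsXGroup.of_mulEquiv {G H : Type*} [Group G] [Group H] (h : IsXGroup G) (e : H ≃* G) :
    IsXGroup H := by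
  intro K hK x hx
  have h1 : ¬ IsCyclic (K.map e.toMonoidHom) := fun hc =>
    hK ((K.equivMapOfInjective e.toMonoidHom e.injective).isCyclic.2 hc)
  have h2 : e x ∈ K.map e.toMonoidHom := by
    refine h _ h1 ?_
    rw [Subgroup.mem_centralizer_iff] at hx ⊢
    rintro _ ⟨y, hy, rfl⟩
    change e y * e x = e x * e y
    rw [← map_mul, hx y hy, map_mul]
  obtain ⟨y, hy, hyx⟩ := h2
  rwa [e.injective hyx] at hy

theorem IsOfFinOrder.of_zpow {G : Type*} [Group G] {a : G} {n : ℤ} (h : IsOfFinOrder (a ^ n))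
    (hn : n ≠ 0) : IsOfFinOrder a := by
  obtain ⟨m, hm, h1⟩ := isOfFinOrder_iff_zpow_eq_one.1 h
  exact isOfFinOrder_iff_zpow_eq_one.2 ⟨n * m, mul_ne_zero hn hm, by rw [zpow_mul, h1]⟩

section Comm

variable {A : Type*} [CommGroup A]

theorem IsXGroup.eq_top (hA : IsXGroup A) {H : Subgroup A} (hH : ¬ IsCyclic H) : H = ⊤ :=
  top_le_iff.1 fun x _ => hA H hH (Subgroup.mem_centralizer_iff.2 fun y _ => mul_comm y x)

theorem not_isCyclic_of_torsion_of_not_torsion {G : Type*} [Group G] {k a : G} (hk : k ≠ 1)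
    (hk' : IsOfFinOrder k) (ha : ¬ IsOfFinOrder a) (H : Subgroup G) (hkH : k ∈ H) (haH : a ∈ H) :
    ¬ IsCyclic H := by
  rw [Subgroup.isCyclic_iff_exists_zpowers_eq_top]
  rintro ⟨g, rfl⟩
  obtain ⟨i, rfl⟩ := hkH
  obtain ⟨j, rfl⟩ := haH
  have hg : ¬ IsOfFinOrder g := fun h => ha h.zpow
  have hi : i ≠ 0 := by rintro rfl; exact hk (zpow_zero g)
  exact hg ((IsOfFinOrder.of_zpow hk' hi))

/-- A non-trivial element of finite order and one of infinite order do not coexist in an abelian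
`𝔛`-group. -/
theorem IsXGroup.eq_one_of_isOfFinOrder (hA : IsXGroup A) {k a : A} (hk' : IsOfFinOrder k)
    (ha : ¬ IsOfFinOrder a) : k = 1 := by
  by_contra hk
  -- `⟨k, a ^ 2⟩` is non-cyclic, hence everything; but writing `a` in it makes an odd power of `a`
  -- torsion.
  have ha2 : ¬ IsOfFinOrder (a ^ 2) := fun h => ha (h.of_pow two_ne_zero)
  have htop := hA.eq_top (not_isCyclic_of_torsion_of_not_torsion hk hk' ha2
    (Subgroup.zpowers k ⊔ Subgroup.zpowers (a ^ 2))
    (Subgroup.mem_sup_left (Subgroup.mem_zpowers k))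
    (Subgroup.mem_sup_right (Subgroup.mem_zpowers _)))
  have hmem : a ∈ Subgroup.zpowers k ⊔ Subgroup.zpowers (a ^ 2) := htop ▸ Subgroup.mem_top a
  obtain ⟨_, ⟨i, rfl⟩, _, ⟨j, rfl⟩, h⟩ := Subgroup.mem_sup.1 hmem
  simp only at h
  have h1 : k ^ i = a ^ (1 - 2 * j) := by
    rw [zpow_sub, zpow_one, zpow_mul, eq_mul_inv_iff_mul_eq]
    exact_mod_cast h
  have h2 : IsOfFinOrder (a ^ (1 - 2 * j)) := h1 ▸ hk'.zpow
  exact ha (IsOfFinOrder.of_zpow h2 (by omega))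

theorem finite_of_isCyclic_of_isOfFinOrder {G : Type*} [Group G] [IsCyclic G]
    (h : ∀ x : G, IsOfFinOrder x) : Finite G := by
  obtain ⟨g, hg⟩ := IsCyclic.exists_generator (α := G)
  have : Finite (Subgroup.zpowers g) := finite_zpowers.2 (h g)
  rw [← Set.finite_univ_iff]
  convert (Set.toFinite (Subgroup.zpowers g : Set G))
  ext x; simp [hg x]

theorem IsXGroup.finite_of_pow_prime_eq_one (hA : IsXGroup A) (p : ℕ) [hp : Fact p.Prime]
    (h : ∀ x : A, x ^ p = 1) : Finite A := by
  by_contra hinf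
  rw [not_finite_iff_infinite] at hinf
  have hfin : ∀ x : A, IsOfFinOrder x := fun x =>
    isOfFinOrder_iff_pow_eq_one.2 ⟨p, hp.out.pos, h x⟩
  obtain ⟨x, hx⟩ := exists_ne (1 : A)
  have hfx : Finite (Subgroup.zpowers x) := finite_zpowers.2 (hfin x)
  obtain ⟨y, hy⟩ : ∃ y, y ∉ Subgroup.zpowers x := by
    by_contra! hall
    exact hinf.not_finite (Set.finite_univ_iff.1
      ((Set.toFinite (Subgroup.zpowers x : Set A)).subset fun z _ => hall z))
  have hfy : Finite (Subgroup.zpowers y) := finite_zpowers.2 (hfin y)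
  by_cases hc : IsCyclic ↥(Subgroup.zpowers x ⊔ Subgroup.zpowers y)
  · obtain ⟨g, hg⟩ := (Subgroup.isCyclic_iff_exists_zpowers_eq_top _).1 hc
    have hxg : Subgroup.zpowers x ≤ Subgroup.zpowers g := hg ▸ le_sup_left
    have hyg : y ∈ Subgroup.zpowers g := hg ▸ Subgroup.mem_sup_right (Subgroup.mem_zpowers y)
    have hfg : Finite (Subgroup.zpowers g) := finite_zpowers.2 (hfin g)
    have hle : orderOf g ≤ orderOf x := by
      rw [orderOf_eq_prime (h x) hx]
      exact Nat.le_of_dvd hp.out.pos (orderOf_dvd_of_pow_eq_one (h g))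
    have := Subgroup.eq_of_le_of_card_ge hxg (by rwa [Nat.card_zpowers, Nat.card_zpowers])
    exact hy (this ▸ hyg)
  · have htop := hA.eq_top hc
    refine hinf.not_finite (Finite.of_surjective
      (fun q : Subgroup.zpowers x × Subgroup.zpowers y => (q.1 : A) * q.2) fun z => ?_)
    obtain ⟨u, hu, v, hv, huv⟩ := Subgroup.mem_sup.1 (htop ▸ Subgroup.mem_top z)
    exact ⟨(⟨u, hu⟩, ⟨v, hv⟩), huv⟩

/-- Otherwise the image of the power map is cyclic. In the torsion case image and kernel are both
finite; with an element of infinite order the kernel is trivial and `A` is isomorphic to the cyclic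
image. -/
theorem IsXGroup.pow_prime_surjective [Infinite A] (hA : IsXGroup A) (hc : ¬ IsCyclic A) (p : ℕ)
    [hp : Fact p.Prime] (x : A) : ∃ y, y ^ p = x := by
  suffices h : (powMonoidHom p : A →* A).range = ⊤ from MonoidHom.range_eq_top.1 h x
  by_contra hne
  have hcr : IsCyclic (powMonoidHom p : A →* A).range := by
    by_contra h
    exact hne (hA.eq_top h)
  have hkfin : ∀ x ∈ (powMonoidHom p : A →* A).ker, IsOfFinOrder x := fun x hx =>
    isOfFinOrder_iff_pow_eq_one.2 ⟨p, hp.out.pos, hx⟩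
  by_cases htor : ∀ a : A, IsOfFinOrder a
  · have hrf : Finite (powMonoidHom p : A →* A).range :=
      finite_of_isCyclic_of_isOfFinOrder fun x => Submonoid.isOfFinOrder_coe.1 (htor x)
    have hkf : Finite (powMonoidHom p : A →* A).ker := by
      by_cases hck : IsCyclic (powMonoidHom p : A →* A).ker
      · exact finite_of_isCyclic_of_isOfFinOrder fun x => Submonoid.isOfFinOrder_coe.1 (htor x)
      · have htop := hA.eq_top hck
        have := hA.finite_of_pow_prime_eq_one p fun x => (htop ▸ Subgroup.mem_top x :
          x ∈ (powMonoidHom p : A →* A).ker)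
        exact (not_finite A).elim
    exact not_finite_iff_infinite.2 ‹Infinite A›
      ((MonoidHom.finite_iff_finite_ker_range (powMonoidHom p)).2 ⟨hkf, hrf⟩)
  · push Not at htor
    obtain ⟨a, ha⟩ := htor
    have hinj : Function.Injective (powMonoidHom p : A →* A) := by
      rw [injective_iff_map_eq_one]
      exact fun k hk => hA.eq_one_of_isOfFinOrder (hkfin k hk) ha
    exact hc ((MonoidHom.ofInjective hinj).isCyclic.2 hcr)

/-- Iterated square roots of an `a` of infinite order generate a copy of `ℤ[1/2]`. It is not cyclic,
so it is everything, yet it contains no cube root of `a`. -/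
theorem IsXGroup.isOfFinOrder_of_not_isCyclic (hA : IsXGroup A) (hc : ¬ IsCyclic A) (a : A) :
    IsOfFinOrder a := by
  by_contra ha
  have : Infinite A := by
    by_contra h
    rw [not_infinite_iff_finite] at h
    exact ha (isOfFinOrder_of_finite a)
  obtain ⟨x, hx0, hx⟩ := exists_seq_of_surjective (f := fun g : A => g ^ 2)
    (fun g => hA.pow_prime_surjective hc 2 g) a
  have hmono : Monotone fun n => Subgroup.zpowers (x n) := by
    refine monotone_nat_of_le_succ fun n => Subgroup.zpowers_le.2 ⟨2, ?_⟩
    simp only [← hx n]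
    norm_cast
  have hmem : ∀ g, g ∈ (⨆ n, Subgroup.zpowers (x n)) ↔ ∃ n, g ∈ Subgroup.zpowers (x n) :=
    fun g => Subgroup.mem_iSup_of_directed hmono.directed_le
  have hpow : ∀ n, x n ^ 2 ^ n = a := by
    intro n
    induction n with
    | zero => simpa using hx0
    | succ n ih => rw [pow_succ', pow_mul, ← ih, ← hx n]
  have hxinf : ∀ n, ¬ IsOfFinOrder (x n) := fun n h => ha (hpow n ▸ h.pow)
  by_cases hcy : IsCyclic ↥(⨆ n, Subgroup.zpowers (x n))
  · obtain ⟨g, hg⟩ := (Subgroup.isCyclic_iff_exists_zpowers_eq_top _).1 hcy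
    obtain ⟨n, hn⟩ := (hmem g).1 (hg ▸ Subgroup.mem_zpowers g)
    have h2 : x (n + 1) ∈ Subgroup.zpowers g :=
      hg ▸ (hmem _).2 ⟨n + 1, Subgroup.mem_zpowers _⟩
    obtain ⟨k, hk⟩ := (Subgroup.zpowers_le.2 hn) h2
    have h3 : x (n + 1) ^ (2 * k) = x (n + 1) ^ (1 : ℤ) := by
      rw [zpow_one, zpow_mul, zpow_ofNat, hx n]
      exact hk
    have := injective_zpow_iff_not_isOfFinOrder.2 (hxinf (n + 1)) h3
    omega
  · have htop := hA.eq_top hcy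
    obtain ⟨g, hg⟩ := hA.pow_prime_surjective hc 3 a
    obtain ⟨n, k, rfl⟩ := (hmem g).1 (htop ▸ Subgroup.mem_top g)
    have h3 : x n ^ (k * 3) = x n ^ ((2 ^ n : ℕ) : ℤ) := by
      rw [zpow_natCast, hpow, ← hg, zpow_mul]
      norm_cast
    have h4 := injective_zpow_iff_not_isOfFinOrder.2 (hxinf n) h3
    have h5 : 3 ∣ 2 ^ n := by
      have : (3 : ℤ) ∣ ((2 ^ n : ℕ) : ℤ) := ⟨k, by rw [← h4, mul_comm]⟩
      exact_mod_cast this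
    have := Nat.prime_three.dvd_of_dvd_pow h5
    omega

end Comm

/-- An infinite abelian `𝔛`-group is cyclic or a Prüfer group. -/
theorem IsXGroup.isCyclic_or_pruferGroup {A : Type*} [Group A] [Infinite A]
    (hcomm : ∀ a b : A, a * b = b * a) (hA : IsXGroup A) :
    IsCyclic A ∨ ∃ p : ℕ, p.Prime ∧ Nonempty (A ≃* PruferGroup p) := by
  let _ : CommGroup A := { ‹Group A› with mul_comm := hcomm }
  rw [or_iff_not_imp_left]
  intro hc
  obtain ⟨a, ha⟩ := exists_ne (1 : A)
  have hfin := hA.isOfFinOrder_of_not_isCyclic hc a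
  obtain ⟨p, hp, m, hm⟩ := Nat.exists_prime_and_dvd (mt orderOf_eq_one_iff.1 ha)
  have : Fact p.Prime := ⟨hp⟩
  have hmpos : 0 < m := Nat.pos_of_mul_pos_left (hm ▸ hfin.orderOf_pos)
  have hz : (a ^ m) ^ p = 1 := by rw [← pow_mul, mul_comm, ← hm, pow_orderOf_eq_one]
  have hz1 : a ^ m ≠ 1 := by
    intro h
    have := Nat.le_of_dvd hmpos (orderOf_dvd_of_pow_eq_one h)
    rw [hm] at this
    nlinarith [hp.two_le]
  obtain ⟨x, hx⟩ := exists_isPruferChain (hA.pow_prime_surjective hc p) hz hz1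
  refine ⟨p, hp, hx.nonempty_mulEquiv_pruferGroup fun g => ?_⟩
  rw [← hx.mem_iSup_iff, hA.eq_top hx.not_isCyclic]
  trivial

/-! ### Commuting with an element of infinite order. -/

section Commuting

variable {G : Type*} [Group G] {a x : G}

/-- Two commuting elements of an `𝔛`-group, one of infinite order, generate a cyclic group. -/
theorem IsXGroup.exists_zpow_eq (hG : IsXGroup G) (ha : ¬ IsOfFinOrder a) (hax : Commute a x) :
    ∃ (g : G) (i j : ℤ), ¬ IsOfFinOrder g ∧ j ≠ 0 ∧ g ^ i = x ∧ g ^ j = a := by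
  have hcomm : ∀ u ∈ ({a, x} : Set G), ∀ v ∈ ({a, x} : Set G), u * v = v * u := by
    rintro u (rfl | rfl) v (rfl | rfl)
    exacts [rfl, hax, hax.symm, rfl]
  have hK := Subgroup.isMulCommutative_closure hcomm
  set K := Subgroup.closure ({a, x} : Set G)
  have haK : a ∈ K := Subgroup.subset_closure (by simp)
  have hxK : x ∈ K := Subgroup.subset_closure (by simp)
  have haK' : ¬ IsOfFinOrder (⟨a, haK⟩ : K) := fun h => ha (Submonoid.isOfFinOrder_coe.2 h)
  have : Infinite K := by
    by_contra h
    rw [not_infinite_iff_finite] at h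
    exact haK' (isOfFinOrder_of_finite _)
  have hcyc : IsCyclic K := by
    rcases (hG.subgroup K).isCyclic_or_pruferGroup (fun u v => hK.is_comm.comm u v) with
      h | ⟨p, hp, ⟨e⟩⟩
    · exact h
    · have := Fact.mk hp
      exact absurd (PruferGroup.isOfFinOrder_of_mulEquiv e _) haK'
  obtain ⟨g, hg⟩ := (Subgroup.isCyclic_iff_exists_zpowers_eq_top _).1 hcyc
  obtain ⟨i, hi⟩ : x ∈ Subgroup.zpowers g := hg ▸ hxK
  obtain ⟨j, hj⟩ : a ∈ Subgroup.zpowers g := hg ▸ haK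
  refine ⟨g, i, j, fun h => ha (hj ▸ h.zpow), ?_, hi, hj⟩
  rintro rfl
  simp only [zpow_zero] at hj
  exact ha (hj ▸ IsOfFinOrder.one)

theorem IsXGroup.eq_one_of_commute (hG : IsXGroup G) (ha : ¬ IsOfFinOrder a)
    (hax : Commute a x) (hx : IsOfFinOrder x) : x = 1 := by
  obtain ⟨g, i, j, hg, -, rfl, -⟩ := hG.exists_zpow_eq ha hax
  have : i = 0 := by
    by_contra h
    exact hg (IsOfFinOrder.of_zpow hx h)
  rw [this, zpow_zero]

theorem IsXGroup.exists_zpow_eq_zpow (hG : IsXGroup G) (ha : ¬ IsOfFinOrder a)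
    (hax : Commute a x) : ∃ s t : ℤ, s ≠ 0 ∧ x ^ s = a ^ t := by
  obtain ⟨g, i, j, -, hj, rfl, rfl⟩ := hG.exists_zpow_eq ha hax
  exact ⟨j, i, hj, zpow_comm g i j⟩

end Commuting

/-! ### Soluble 𝔛-groups: an infinite abelian normal subgroup. -/

section FiniteClasses

open scoped commutatorElement

variable {G : Type*} [Group G]

/-- If an infinite subgroup `K` moves each element of the finite set `S` to finitely many
conjugates, it centralizes `S` up to finite index. -/
theorem infinite_inf_centralizer {K : Subgroup G} [hK : Infinite K] {S : Set G} (hS : S.Finite)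
    {T : Set G} (hT : T.Finite) (h : ∀ s ∈ S, ∀ k ∈ K, k * s * k⁻¹ ∈ T) :
    Infinite ↥(K ⊓ Subgroup.centralizer S) := by
  have := hS.to_subtype
  have := hT.to_subtype
  let f : K → (S → T) := fun k s => ⟨k * s * k⁻¹, h s s.2 k k.2⟩
  -- Two elements of `K` inducing the same conjugation on `S` differ by an element centralizing `S`.
  obtain ⟨y, hy⟩ := Finite.exists_infinite_fiber f
  obtain ⟨⟨k₀, hk₀⟩⟩ : Nonempty (f ⁻¹' {y}) := inferInstance
  refine Infinite.of_injective (fun k : f ⁻¹' {y} =>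
    (⟨(k₀ : G)⁻¹ * (k : K), K.mul_mem (K.inv_mem k₀.2) (k : K).2, ?_⟩ :
      ↥(K ⊓ Subgroup.centralizer S))) ?_
  · refine Subgroup.mem_centralizer_iff.2 fun s hs => ?_
    have h1 : f k = f k₀ := k.2.trans hk₀.symm
    have h2 : (k : G) * s * (k : G)⁻¹ = k₀ * s * (k₀ : G)⁻¹ :=
      congrArg Subtype.val (congrFun h1 ⟨s, hs⟩)
    rw [mul_inv_eq_iff_eq_mul] at h2
    rw [mul_assoc, h2]
    group
  · intro k l hkl
    exact Subtype.ext (Subtype.ext (mul_left_cancel (congrArg Subtype.val hkl)))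

theorem mul_conj_mem_of_commutator {K : Subgroup G} {s k : G} (hs : s ∈ K) (hk : k ∈ K) :
    k * s * k⁻¹ ∈ (fun c => c * s) '' (⁅K, K⁆ : Subgroup G) :=
  ⟨⁅k, s⁆, Subgroup.commutator_mem_commutator hk hs, by simp [commutatorElement_def]⟩

end FiniteClasses

section Soluble

open scoped commutatorElement

variable {G : Type*} [Group G]

/-- `K` is the last infinite term of the derived series. -/
theorem exists_infinite_normal_finite_commutator [Infinite G] [hs : Group.IsSolvable G] :
    ∃ K : Subgroup G, K.Normal ∧ Infinite K ∧ Finite (⁅K, K⁆ : Subgroup G) := by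
  classical
  have hex : ∃ n, Finite (derivedSeries G n) := by
    obtain ⟨n, hn⟩ := (Group.isSolvable_def G).1 hs
    exact ⟨n, by rw [hn]; infer_instance⟩
  have hspec := Nat.find_spec hex
  have hmin := fun m => Nat.find_min hex (m := m)
  set n := Nat.find hex
  rcases n with _ | n
  · rw [derivedSeries_zero] at hspec
    exact absurd (Subgroup.topEquiv.toEquiv.finite_iff.1 hspec) (not_finite_iff_infinite.2 ‹_›)
  · exact ⟨derivedSeries G n, inferInstance, not_finite_iff_infinite.1 (hmin n (by omega)), hspec⟩

/-- An infinite soluble `𝔛`-group has an infinite abelian normal subgroup. -/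
theorem IsXGroup.exists_infinite_normal_comm [Infinite G] [hs : Group.IsSolvable G]
    (hG : IsXGroup G) : ∃ A : Subgroup G, A.Normal ∧ Infinite A ∧
      ∀ a ∈ A, ∀ b ∈ A, a * b = b * a := by
  obtain ⟨K, hKn, hKi, hKf⟩ := exists_infinite_normal_finite_commutator (G := G)
  have hK'n : (⁅K, K⁆ : Subgroup G).Normal := inferInstance
  -- Commutators of elements of `C` lie in `⁅K, K⁆`, so they are central in `C`. If the centre `Z`
  -- is finite, this gives `C` finite exponent.
  set C := K ⊓ Subgroup.centralizer ((⁅K, K⁆ : Subgroup G) : Set G) with hC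
  have hCn : C.Normal := inferInstance
  have hCi : Infinite C := infinite_inf_centralizer (Set.toFinite _) (Set.toFinite _)
    fun s hs k _ => hK'n.conj_mem s hs k
  have hcomm : ∀ x ∈ C, ∀ y ∈ C, ⁅x, y⁆ ∈ (⁅K, K⁆ : Subgroup G) := fun x hx y hy =>
    Subgroup.commutator_mem_commutator hx.1 hy.1
  set Z := C ⊓ Subgroup.centralizer (C : Set G) with hZ
  have hZn : Z.Normal := inferInstance
  by_cases hZi : Infinite Z
  · exact ⟨Z, hZn, hZi, fun a ha b hb => Subgroup.mem_centralizer_iff.1 hb.2 a ha.1⟩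
  rw [not_infinite_iff_finite] at hZi
  obtain ⟨x, hx, y, hy, hxy⟩ : ∃ x ∈ C, ∃ y ∈ C, x * y ≠ y * x := by
    by_contra! h
    refine hCi.not_finite (Finite.Set.subset (Z : Set G) fun x hx => ?_)
    exact ⟨hx, Subgroup.mem_centralizer_iff.2 fun y hy => h y hy x hx⟩
  set n := Nat.card (⁅K, K⁆ : Subgroup G) with hn
  have hnpos : 0 < n := Nat.card_pos
  have hpow : ∀ u ∈ C, u ^ n ∈ Z := by
    intro u hu
    refine ⟨C.pow_mem hu n, Subgroup.mem_centralizer_iff.2 fun v hv => ?_⟩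
    have h1 : Commute ⁅v, u⁆ u :=
      (Subgroup.mem_centralizer_iff.1 hu.2 _ (hcomm v hv u hu))
    have h2 : v * u * v⁻¹ = ⁅v, u⁆ * u := by simp [commutatorElement_def]
    have h3 : ⁅v, u⁆ ^ n = 1 := by
      have := pow_card_eq_one' (G := (⁅K, K⁆ : Subgroup G)) (x := ⟨_, hcomm v hv u hu⟩)
      exact congrArg Subtype.val this
    have h4 : v * u ^ n * v⁻¹ = u ^ n := by
      rw [← conj_pow, h2, h1.mul_pow, h3, one_mul]
    rwa [mul_inv_eq_iff_eq_mul] at h4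
  have hexp : ∀ u ∈ C, u ^ (n * Nat.card Z) = 1 := by
    intro u hu
    rw [pow_mul]
    exact congrArg Subtype.val (pow_card_eq_one' (G := Z) (x := ⟨_, hpow u hu⟩))
  set H := Subgroup.closure ({x, y} : Set G) with hH
  have hHC : H ≤ C := (Subgroup.closure_le _).2 (by
    rintro _ (rfl | rfl)
    exacts [hx, hy])
  have hHc : ¬ IsCyclic H := by
    intro h
    have := h.commGroup.mul_comm (⟨x, Subgroup.subset_closure (by simp)⟩ : H)
      ⟨y, Subgroup.subset_closure (by simp)⟩
    exact hxy (congrArg Subtype.val this)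
  -- `B` centralizes the non-cyclic `⟨x, y⟩`, so it lies inside it and is abelian. Being infinite of
  -- finite exponent, it is neither cyclic nor Prüfer.
  set B := C ⊓ Subgroup.centralizer ({x, y} : Set G) with hB
  have hBi : Infinite B := infinite_inf_centralizer (Set.toFinite _)
    ((Set.toFinite ((fun c => c * x) '' ((⁅K, K⁆ : Subgroup G) : Set G))).union
      (Set.toFinite ((fun c => c * y) '' ((⁅K, K⁆ : Subgroup G) : Set G)))) (by
    rintro s (rfl | rfl) k hk
    · exact Or.inl (mul_conj_mem_of_commutator hx.1 hk.1)
    · exact Or.inr (mul_conj_mem_of_commutator hy.1 hk.1))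
  have hBH : B ≤ H := fun b hb => hG H hHc (by
    rw [hH, Subgroup.centralizer_closure]
    exact hb.2)
  have hBcomm : ∀ a b : B, a * b = b * a := by
    intro a b
    have h1 : (b : G) ∈ Subgroup.centralizer (H : Set G) := by
      rw [hH, Subgroup.centralizer_closure]
      exact b.2.2
    exact Subtype.ext (Subgroup.mem_centralizer_iff.1 h1 a (hBH a.2))
  have hBexp : ∀ b : B, b ^ (n * Nat.card Z) = 1 := fun b => Subtype.ext (hexp b b.2.1)
  have hmpos : 0 < n * Nat.card Z := Nat.mul_pos hnpos Nat.card_pos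
  exfalso
  rcases (hG.subgroup B).isCyclic_or_pruferGroup hBcomm with h | ⟨p, hp, ⟨e⟩⟩
  · have := finite_of_isCyclic_of_isOfFinOrder fun b : B =>
      isOfFinOrder_iff_pow_eq_one.2 ⟨_, hmpos, hBexp b⟩
    exact not_finite B
  · have := Fact.mk hp
    obtain ⟨c, hc⟩ := PruferGroup.exists_chain p
    set m := n * Nat.card Z
    have h1 : c m ^ m = 1 := by
      rw [← e.apply_symm_apply (c m), ← map_pow, hBexp, map_one]
    have h2 := Nat.le_of_dvd hmpos (orderOf_dvd_of_pow_eq_one h1)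
    rw [hc.orderOf_eq] at h2
    have h3 := Nat.lt_pow_self hp.one_lt (n := m + 1)
    omega

/-- In a soluble `𝔛`-group, the centralizer of an element of infinite order is abelian. -/
theorem IsXGroup.centralizer_comm [hs : Group.IsSolvable G] (hG : IsXGroup G) {a : G}
    (ha : ¬ IsOfFinOrder a) {x y : G} (hx : Commute a x) (hy : Commute a y) : x * y = y * x := by
  obtain ⟨N, hN⟩ := (Group.isSolvable_def G).1 hs
  -- Induction up the derived series from its trivial term.
  have key : ∀ k ≤ N, ∀ x ∈ derivedSeries G (N - k), ∀ y ∈ derivedSeries G (N - k),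
      Commute a x → Commute a y → x * y = y * x := by
    intro k
    induction k with
    | zero =>
      intro _ x hx y hy _ _
      rw [Nat.sub_zero, hN, Subgroup.mem_bot] at hx
      rw [hx, one_mul, mul_one]
    | succ k ih =>
      intro hk x hx y hy hax hay
      specialize ih (by omega)
      have hcm : ∀ u ∈ derivedSeries G (N - (k + 1)), ∀ v ∈ derivedSeries G (N - (k + 1)),
          ⁅u, v⁆ ∈ derivedSeries G (N - k) := by
        intro u hu v hv
        rw [show N - k = N - (k + 1) + 1 by omega, derivedSeries_succ]
        exact Subgroup.commutator_mem_commutator hu hv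
      have hac : ∀ {u v : G}, Commute a u → Commute a v → Commute a ⁅u, v⁆ := by
        intro u v hu hv
        rw [commutatorElement_def]
        exact ((hu.mul_right hv).mul_right hu.inv_right).mul_right hv.inv_right
      have htf : ∀ {u : G} {s : ℤ}, s ≠ 0 → Commute a u → u ^ s = 1 → u = 1 := by
        intro u s hs hu h1
        exact hG.eq_one_of_commute ha hu (isOfFinOrder_iff_zpow_eq_one.2 ⟨s, hs, h1⟩)
      -- Some non-zero power of `c` is a power of `a`, hence fixed by `x`. So `x * c * x⁻¹ * c⁻¹` is
      -- torsion and commutes with `a`, which makes it trivial.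
      have hnorm : ∀ c ∈ derivedSeries G (N - k), Commute a c → x * c * x⁻¹ = c := by
        intro c hc hac'
        obtain ⟨s, t, hs0, hst⟩ := hG.exists_zpow_eq_zpow ha hac'
        have hc' : x * c * x⁻¹ ∈ derivedSeries G (N - k) :=
          (derivedSeries_normal G (N - k)).conj_mem c hc x
        have hac'' : Commute a (x * c * x⁻¹) := (hax.mul_right hac').mul_right hax.inv_right
        have hcc : Commute (x * c * x⁻¹) c := ih _ hc' _ hc hac'' hac'
        have h1 : (x * c * x⁻¹) ^ s = c ^ s := by
          rw [conj_zpow, hst, mul_inv_eq_iff_eq_mul]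
          exact ((hax.zpow_left t).eq).symm
        have h2 : (x * c * x⁻¹ * c⁻¹) ^ s = 1 := by
          rw [(hcc.inv_right).mul_zpow, h1, inv_zpow, mul_inv_cancel]
        exact mul_inv_eq_one.1 (htf hs0 (hac''.mul_right hac'.inv_right) h2)
      have hxc : Commute ⁅y, x⁆ x := by
        have := hnorm _ (hcm y hy x hx) (hac hay hax)
        rw [mul_inv_eq_iff_eq_mul] at this
        exact this.symm
      obtain ⟨s, t, hs0, hst⟩ := hG.exists_zpow_eq_zpow ha hax
      have h1 : ⁅y, x⁆ ^ s = 1 := by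
        have h2 : y * x * y⁻¹ = ⁅y, x⁆ * x := by simp [commutatorElement_def]
        have h3 : (y * x * y⁻¹) ^ s = x ^ s := by
          rw [conj_zpow, hst, mul_inv_eq_iff_eq_mul]
          exact ((hay.zpow_left t).eq).symm
        rw [h2, hxc.mul_zpow] at h3
        simpa using h3
      have h4 := htf hs0 (hac hay hax) h1
      exact (commutatorElement_eq_one_iff_mul_comm.1 h4).symm
  have := key N le_rfl x (by simp) y (by simp) hx hy
  exact this

end Soluble

/-! ### The case of an infinite cyclic normal subgroup. -/

section Dihedral

variable {G : Type*} [Group G]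

/-- The homomorphism from the infinite dihedral group given by an element and an involution
inverting it. -/
noncomputable def dihedralHom (b t : G) (ht : t * t = 1) (hb : t * b * t⁻¹ = b⁻¹) :
    DihedralGroup 0 →* G where
  toFun
    | .r i => b ^ (show ℤ from i)
    | .sr i => t * b ^ (show ℤ from i)
  map_one' := zpow_zero b
  map_mul' := by
    have ht' : t⁻¹ = t := inv_eq_of_mul_eq_one_left ht
    have hbt : ∀ k : ℤ, b ^ k * t = t * b ^ (-k) := by
      intro k
      rw [zpow_neg, ← inv_zpow, ← hb, conj_zpow, ht', ← mul_assoc, ← mul_assoc, ht, one_mul]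
    rintro (i | i) (j | j)
    · exact zpow_add b i j
    · change t * b ^ ((show ℤ from j) - (show ℤ from i)) = b ^ (show ℤ from i) *
        (t * b ^ (show ℤ from j))
      rw [← mul_assoc, hbt, mul_assoc, ← zpow_add]
      congr 2
      exact (neg_add_eq_sub _ _).symm
    · change t * b ^ ((show ℤ from i) + (show ℤ from j)) = t * b ^ (show ℤ from i) *
        b ^ (show ℤ from j)
      rw [mul_assoc, ← zpow_add]
    · change b ^ ((show ℤ from j) - (show ℤ from i)) = t * b ^ (show ℤ from i) *
        (t * b ^ (show ℤ from j))
      rw [mul_assoc, ← mul_assoc _ t, hbt, mul_assoc t, ← zpow_add, ← mul_assoc, ht, one_mul]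
      congr 1
      exact (neg_add_eq_sub _ _).symm

theorem IsXGroup.cyclic_or_dihedral [hs : Group.IsSolvable G] (hG : IsXGroup G)
    {A : Subgroup G} (hAn : A.Normal) (hAi : Infinite A) (hAc : IsCyclic A) :
    IsCyclic G ∨ Nonempty (G ≃* DihedralGroup 0) := by
  obtain ⟨a, rfl⟩ := (Subgroup.isCyclic_iff_exists_zpowers_eq_top _).1 hAc
  have ha : ¬ IsOfFinOrder a := fun h => by
    have := finite_zpowers.2 h
    exact hAi.not_finite this
  set C := Subgroup.centralizer (Subgroup.zpowers a : Set G) with hC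
  have hmem : ∀ x, x ∈ C ↔ Commute a x := by
    intro x
    rw [hC, Subgroup.mem_centralizer_iff]
    constructor
    · exact fun h => h a (Subgroup.mem_zpowers a)
    · rintro h _ ⟨k, rfl⟩
      exact h.zpow_left k
  have haC : a ∈ C := (hmem a).2 (Commute.refl a)
  have hCn : C.Normal := inferInstance
  have hCi : Infinite C := by
    by_contra h
    rw [not_infinite_iff_finite] at h
    exact ha (Submonoid.isOfFinOrder_coe.2 (isOfFinOrder_of_finite (⟨a, haC⟩ : C)))
  have hCc : IsCyclic C := by
    rcases (hG.subgroup C).isCyclic_or_pruferGroup (fun x y => Subtype.ext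
      (hG.centralizer_comm ha ((hmem x).1 x.2) ((hmem y).1 y.2))) with h | ⟨p, hp, ⟨e⟩⟩
    · exact h
    · have := Fact.mk hp
      exact absurd (Submonoid.isOfFinOrder_coe.2 
        (PruferGroup.isOfFinOrder_of_mulEquiv e ⟨a, haC⟩)) ha
  obtain ⟨b, hb⟩ := (Subgroup.isCyclic_iff_exists_zpowers_eq_top _).1 hCc
  have hbC : b ∈ C := hb ▸ Subgroup.mem_zpowers b
  obtain ⟨m, hm⟩ : a ∈ Subgroup.zpowers b := hb ▸ haC
  have hbi : ¬ IsOfFinOrder b := fun h => ha (hm ▸ h.zpow)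
  have hinj := injective_zpow_iff_not_isOfFinOrder.2 hbi
  by_cases htop : C = ⊤
  · left
    rw [htop] at hCc
    exact Subgroup.topEquiv.isCyclic.1 hCc
  right
  have hbcomm : ∀ x, Commute b x → x ∈ C := fun x hx => (hmem x).2 (hm ▸ hx.zpow_left m)
  have hinv : ∀ t, t ∉ C → t * b * t⁻¹ = b⁻¹ := by
    intro t ht
    obtain ⟨i, hi⟩ : t * b * t⁻¹ ∈ Subgroup.zpowers b := hb ▸ hCn.conj_mem b hbC t
    obtain ⟨j, hj⟩ : t⁻¹ * b * t⁻¹⁻¹ ∈ Subgroup.zpowers b := hb ▸ hCn.conj_mem b hbC t⁻¹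
    -- Conjugation by `t` and by `t⁻¹` are mutually inverse, so `i = ±1`; the value `1` would put
    -- `t` in `C`.
    have h1 : b ^ (i * j) = b ^ (1 : ℤ) := by
      simp only [inv_inv] at hi hj
      have h0 : (t⁻¹ * b * t) ^ i = t⁻¹ * b ^ i * t := by
        simpa only [inv_inv] using (conj_zpow : (t⁻¹ * b * t⁻¹⁻¹) ^ i = _)
      rw [mul_comm, zpow_mul, hj, h0, hi, zpow_one]
      group
    have h2 : i * j = 1 := hinj h1
    rcases Int.eq_one_or_neg_one_of_mul_eq_one h2 with rfl | rfl
    · exfalso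
      apply ht
      apply hbcomm
      simp only [zpow_one] at hi
      rw [eq_mul_inv_iff_mul_eq] at hi
      exact hi
    · simpa using hi.symm
  obtain ⟨t, ht⟩ : ∃ t, t ∉ C := by
    by_contra! h
    exact htop (eq_top_iff.2 fun x _ => h x)
  have hprod : ∀ u v, u ∉ C → v ∉ C → u * v ∈ C := by
    intro u v hu hv
    apply hbcomm
    have h1 : u * v * b * (u * v)⁻¹ = b := by
      have : u * v * b * (u * v)⁻¹ = u * (v * b * v⁻¹) * u⁻¹ := by group
      rw [this, hinv v hv, ← inv_inj, conj_inv, inv_inv, hinv u hu]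
    rw [mul_inv_eq_iff_eq_mul] at h1
    exact h1.symm
  -- `t * t` is a power of `b`, so `t` inverts it, while also commuting with it.
  have htt : t * t = 1 := by
    obtain ⟨k, hk⟩ : t * t ∈ Subgroup.zpowers b := hb ▸ hprod t t ht ht
    simp only at hk
    have h1 : t * b ^ k * t⁻¹ = b ^ k := by rw [hk]; group
    rw [← conj_zpow, hinv t ht, inv_zpow', ] at h1
    have h2 : -k = k := hinj h1
    have h3 : k = 0 := by omega
    rw [← hk, h3, zpow_zero]
  have htinv := hinv t ht
  refine ⟨(MulEquiv.ofBijective (dihedralHom b t htt htinv) ⟨?_, ?_⟩).symm⟩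
  · rw [injective_iff_map_eq_one]
    rintro (i | i) hi
    · have : (show ℤ from i) = 0 := hinj (hi.trans (zpow_zero b).symm)
      exact congrArg DihedralGroup.r this
    · exfalso
      apply ht
      have h1 : t * b ^ (show ℤ from i) = 1 := hi
      rw [eq_inv_of_mul_eq_one_left h1]
      exact C.inv_mem (C.zpow_mem hbC _)
  · intro g
    by_cases hg : g ∈ C
    · obtain ⟨k, hk⟩ : g ∈ Subgroup.zpowers b := hb ▸ hg
      exact ⟨.r (show ZMod 0 from k), hk⟩
    · obtain ⟨k, hk⟩ : t * g ∈ Subgroup.zpowers b := hb ▸ hprod t g ht hg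
      refine ⟨.sr (show ZMod 0 from k), ?_⟩
      change t * b ^ k = g
      simp only at hk
      rw [hk, ← mul_assoc, htt, one_mul]

end Dihedral

/-- Every non-trivial cyclic subgroup contains all elements of order `p`, so one fixed point
suffices for `eq_one_of_fix_torsion`. -/
theorem PruferGroup.eq_one_of_fix_ne_one {p : ℕ} [hp : Fact p.Prime] (hodd : Odd p)
    {α : MulAut (PruferGroup p)} (hα : IsOfFinOrder α) {x : PruferGroup p} (hx : x ≠ 1)
    (hfix : α x = x) : α = 1 := by
  refine eq_one_of_fix_torsion hα (fun y hy => ?_) fun h => absurd hodd (by rw [h]; decide)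
  obtain ⟨k, hk⟩ := exists_orderOf_eq x
  have hk0 : k ≠ 0 := by
    rintro rfl
    exact hx (by rwa [pow_zero, orderOf_eq_one_iff] at hk)
  obtain ⟨j, rfl⟩ : y ∈ Subgroup.zpowers x := by
    refine mem_zpowers_of_pow_orderOf (orderOf_dvd_iff_pow_eq_one.1 ?_)
    rw [hk]
    exact (orderOf_dvd_of_pow_eq_one hy).trans (dvd_pow_self p hk0)
  simp only [map_zpow, hfix]

/-! ### The case of a normal Prüfer subgroup. -/

section NormalPrufer

variable {G : Type*} [Group G] {p : ℕ} {A : Subgroup G} [hAn : A.Normal]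

/-- The conjugation action on a normal subgroup isomorphic to a Prüfer group. -/
noncomputable def conjPrufer (e : A ≃* PruferGroup p) : G →* MulAut (PruferGroup p) :=
  (MulAut.congr e).toMonoidHom.comp MulAut.conjNormal

theorem conjPrufer_apply (e : A ≃* PruferGroup p) (g : G) (a : A) :
    conjPrufer e g (e a) = e ⟨g * a * g⁻¹, hAn.conj_mem a a.2 g⟩ := by
  change e (MulAut.conjNormal g (e.symm (e a))) = _
  rw [e.symm_apply_apply]
  congr 1

theorem conjPrufer_apply_eq_iff (e : A ≃* PruferGroup p) (g : G) (a b : A) :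
    conjPrufer e g (e a) = e b ↔ g * a * g⁻¹ = b := by
  rw [conjPrufer_apply, e.injective.eq_iff]
  exact Subtype.ext_iff

theorem not_isCyclic_of_mulEquiv_pruferGroup [Fact p.Prime] {B : Type*} [Group B]
    (e : B ≃* PruferGroup p) : ¬ IsCyclic B :=
  fun h => PruferGroup.not_isCyclic p (e.isCyclic.1 h)

theorem conjPrufer_eq_one_iff [hp : Fact p.Prime] (hG : IsXGroup G) (e : A ≃* PruferGroup p)
    {g : G} : conjPrufer e g = 1 ↔ g ∈ A := by
  constructor
  · intro h
    refine hG A (not_isCyclic_of_mulEquiv_pruferGroup e)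
      (Subgroup.mem_centralizer_iff.2 fun a ha => ?_)
    have := (conjPrufer_apply_eq_iff e g ⟨a, ha⟩ ⟨a, ha⟩).1 (by rw [h]; rfl)
    rw [mul_inv_eq_iff_eq_mul] at this
    exact this.symm
  · intro h
    ext1 x
    obtain ⟨a, rfl⟩ := e.surjective x
    refine (conjPrufer_apply_eq_iff e g a a).2 ?_
    have : (⟨g, h⟩ : A) * a = a * ⟨g, h⟩ := e.injective (by rw [map_mul, map_mul, mul_comm])
    rw [mul_inv_eq_iff_eq_mul]
    exact congrArg Subtype.val this

/-- Conjugation keeps `a` of order `p` inside the finite group `⟨a⟩`, so a positive power of `g`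
commutes with `a`; infinite order of `g` would force `a = 1`. -/
theorem IsXGroup.isOfFinOrder_of_normal_prufer [hp : Fact p.Prime] (hG : IsXGroup G)
    (e : A ≃* PruferGroup p) (g : G) : IsOfFinOrder g := by
  by_contra hg
  obtain ⟨z, hz⟩ := PruferGroup.exists_orderOf_eq_prime p
  obtain ⟨a, rfl⟩ := e.surjective z
  have hfin : Finite (Subgroup.zpowers (e a)) :=
    finite_zpowers.2 (PruferGroup.isOfFinOrder (e a))
  let f : ℕ → Subgroup.zpowers (e a) := fun i => ⟨(conjPrufer e g ^ i) (e a),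
    PruferGroup.map_mem_zpowers (conjPrufer e g ^ i).toMonoidHom (e a)⟩
  have key : ∀ i j : ℕ, i < j → f i = f j → False := by
    intro i j hij hf
    obtain ⟨k, rfl⟩ := Nat.exists_eq_add_of_lt hij
    have h1 : (conjPrufer e g ^ i) (e a) = (conjPrufer e g ^ (i + k + 1)) (e a) :=
      congrArg Subtype.val hf
    rw [add_assoc, pow_add, MulAut.mul_apply] at h1
    have h2 := (conjPrufer e g ^ i).injective h1
    rw [← map_pow] at h2
    have h3 := (conjPrufer_apply_eq_iff e _ a a).1 h2.symm
    rw [mul_inv_eq_iff_eq_mul] at h3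
    have h4 : ¬ IsOfFinOrder (g ^ (k + 1)) := fun h => hg (h.of_pow (by omega))
    have h5 := hG.eq_one_of_commute h4 h3
      (Submonoid.isOfFinOrder_coe.2 (PruferGroup.isOfFinOrder_of_mulEquiv e a))
    have h6 : a = 1 := Subtype.ext h5
    rw [h6, map_one, orderOf_one] at hz
    exact hp.out.one_lt.ne hz
  obtain ⟨i, j, hij, hf⟩ := Finite.exists_ne_map_eq_of_infinite f
  rcases lt_or_gt_of_ne hij with h | h
  · exact key i j h hf
  · exact key j i h hf.symm

theorem IsXGroup.mulEquiv_or_semidirectProduct [hp : Fact p.Prime] (hodd : Odd p)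
    (hG : IsXGroup G) (e : A ≃* PruferGroup p) :
    Nonempty (G ≃* PruferGroup p) ∨
    ∃ (φ : MulAut (PruferGroup p)) (D : Subgroup (MulAut (PruferGroup p))),
      orderOf φ = p - 1 ∧ D ≤ Subgroup.zpowers φ ∧ D ≠ ⊥ ∧
      Nonempty (G ≃* PruferGroup p ⋊[D.subtype] D) := by
  set ρ := conjPrufer e with hρ
  have hρfin : ∀ g, IsOfFinOrder (ρ g) := fun g =>
    ρ.isOfFinOrder (hG.isOfFinOrder_of_normal_prufer e g)
  have hker : ∀ {g}, ρ g = 1 ↔ g ∈ A := conjPrufer_eq_one_iff hG e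
  obtain ⟨φ, hφ, hφ'⟩ := PruferGroup.exists_mulAut_orderOf_eq p
  have hD : ρ.range ≤ Subgroup.zpowers φ := by
    rintro _ ⟨g, rfl⟩
    exact hφ' hodd _ (hρfin g)
  by_cases hbot : ρ.range = ⊥
  · left
    have htop : A = ⊤ := by
      refine eq_top_iff.2 fun g _ => hker.1 ?_
      have : ρ g ∈ ρ.range := ⟨g, rfl⟩
      rwa [hbot, Subgroup.mem_bot] at this
    exact ⟨Subgroup.topEquiv.symm.trans ((MulEquiv.subgroupCongr htop.symm).trans e)⟩
  right
  obtain ⟨d, hd⟩ := (Subgroup.isCyclic_iff_exists_zpowers_eq_top _).1 (Subgroup.isCyclic_of_le hD)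
  obtain ⟨g, rfl⟩ : d ∈ ρ.range := hd ▸ Subgroup.mem_zpowers d
  -- An element of `A ∩ ⟨g⟩` is fixed by `g`, whose action is non-trivial; this is why the extension
  -- splits.
  have hdisj : ∀ c ∈ A, c ∈ Subgroup.zpowers g → c = 1 := by
    rintro _ hc ⟨i, rfl⟩
    by_contra hne
    apply hbot
    rw [← hd]
    have h1 : ρ g = 1 := by
      refine PruferGroup.eq_one_of_fix_ne_one hodd (hρfin g) (x := e ⟨g ^ i, hc⟩) ?_ ?_
      · rw [Ne, map_eq_one_iff e e.injective]
        exact fun h => hne (congrArg Subtype.val h)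
      · refine (conjPrufer_apply_eq_iff e g _ _).2 ?_
        rw [mul_inv_eq_iff_eq_mul]
        exact (Commute.self_zpow g i).eq
    rw [h1, Subgroup.zpowers_one_eq_bot]
  have hcov : ∀ h, ∃ i : ℤ, h * (g ^ i)⁻¹ ∈ A := by
    intro h
    obtain ⟨i, hi⟩ : ρ h ∈ Subgroup.zpowers (ρ g) := hd ▸ ⟨h, rfl⟩
    refine ⟨i, hker.1 ?_⟩
    simp only at hi
    rw [map_mul, map_inv, map_zpow, hi, mul_inv_cancel]
  have hcompl : A.IsComplement' (Subgroup.zpowers g) := by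
    refine Subgroup.isComplement'_of_disjoint_and_mul_eq_univ ?_ ?_
    · rw [Subgroup.disjoint_def]
      exact fun {c} => hdisj c
    · refine Set.eq_univ_of_forall fun h => ?_
      obtain ⟨i, hi⟩ := hcov h
      exact ⟨_, hi, g ^ i, ⟨i, rfl⟩, inv_mul_cancel_right _ _⟩
  let f : Subgroup.zpowers g →* ρ.range := ρ.rangeRestrict.comp (Subgroup.zpowers g).subtype
  have hf : Function.Bijective f := by
    constructor
    · rw [injective_iff_map_eq_one]
      rintro ⟨c, hc⟩ h
      exact Subtype.ext (hdisj c (hker.1 (congrArg Subtype.val h)) hc)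
    · rintro ⟨x, hx⟩
      rw [← hd] at hx
      obtain ⟨i, rfl⟩ := hx
      exact ⟨⟨g ^ i, i, rfl⟩, Subtype.ext (map_zpow ρ g i)⟩
  refine ⟨φ, ρ.range, hφ, hD, hbot, ⟨(SemidirectProduct.mulEquivSubgroup hcompl).symm.trans
    (SemidirectProduct.congr e (MulEquiv.ofBijective f hf) fun h => ?_)⟩⟩
  ext1 a
  exact (conjPrufer_apply e (h : G) a).symm

theorem IsXGroup.mulEquiv_or_inverting (hG : IsXGroup G) (e : A ≃* PruferGroup 2) :
    Nonempty (G ≃* PruferGroup 2) ∨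
    ∃ (A : Subgroup G) (y : G),
        Nonempty (A ≃* PruferGroup 2) ∧
        (A : Set G) * (Subgroup.zpowers y : Set G) = Set.univ ∧
        (orderOf y = 2 ∨ orderOf y = 4) ∧
        y ^ 2 ∈ A ∧
        ∀ a ∈ A, y⁻¹ * a * y = a⁻¹ := by
  set ρ := conjPrufer e with hρ
  have hker : ∀ {g}, ρ g = 1 ↔ g ∈ A := conjPrufer_eq_one_iff hG e
  by_cases htop : A = ⊤
  · exact Or.inl ⟨Subgroup.topEquiv.symm.trans ((MulEquiv.subgroupCongr htop.symm).trans e)⟩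
  right
  obtain ⟨g, hg⟩ : ∃ g, g ∉ A := by
    by_contra! h
    exact htop (eq_top_iff.2 fun x _ => h x)
  -- On `⟨x⟩` with `x ^ 4 = 1` the action is an `m`-th power map; `m` is odd unless `x = 1`, and odd
  -- squares are `1` mod `4`.
  have hsq : ∀ h, ρ h ^ 2 = 1 := by
    intro h
    have hfix : ∀ x : PruferGroup 2, x ^ 4 = 1 → (ρ h ^ 2) x = x := by
      intro x hx
      obtain ⟨m, hm⟩ := PruferGroup.map_mem_zpowers (ρ h).toMonoidHom x
      change x ^ m = ρ h x at hm
      rw [pow_two, MulAut.mul_apply, ← hm, map_zpow, ← hm, ← zpow_mul]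
      have hx' : x ^ (4 : ℤ) = 1 := by exact_mod_cast hx
      rcases Int.even_or_odd' m with ⟨k, rfl | rfl⟩
      · have h1 : ρ h (x ^ 2) = 1 := by
          rw [map_pow, ← hm, ← zpow_natCast, ← zpow_mul,
            show 2 * k * ((2 : ℕ) : ℤ) = 4 * k by push_cast; ring, zpow_mul, hx', one_zpow]
        have h2 : x ^ 2 = 1 := (map_eq_one_iff (ρ h) (ρ h).injective).1 h1
        have h3 : x = 1 := by
          refine (map_eq_one_iff (ρ h) (ρ h).injective).1 ?_
          rw [← hm, zpow_mul, zpow_ofNat, h2, one_zpow]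
        rw [h3, one_zpow]
      · rw [show (2 * k + 1) * (2 * k + 1) = 4 * (k * k + k) + 1 by ring, zpow_add, zpow_mul, hx',
          one_zpow, one_mul, zpow_one]
    refine PruferGroup.eq_one_of_fix_torsion
      (ρ.isOfFinOrder (hG.isOfFinOrder_of_normal_prufer e h)).pow (fun x hx => hfix x ?_)
      fun _ => hfix
    rw [show 4 = 2 * 2 from rfl, pow_mul, hx, one_pow]
  -- The vanishing norm of an involution reads `x * ρ h x = 1`.
  have hneg : ∀ h, h ∉ A → ∀ x, ρ h x = x⁻¹ := by
    intro h hh x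
    have := PruferGroup.prod_pow_apply_eq_one (mt hker.1 hh) (hsq h) x
    rw [Finset.prod_range_succ, Finset.prod_range_one, pow_zero, pow_one, MulAut.one_apply] at this
    exact eq_inv_of_mul_eq_one_right this
  have hconj : ∀ h, h ∉ A → ∀ a ∈ A, h * a * h⁻¹ = a⁻¹ := fun h hh a ha =>
    (conjPrufer_apply_eq_iff e h ⟨a, ha⟩ ⟨a, ha⟩⁻¹).1 (by rw [map_inv]; exact hneg h hh _)
  have hg2 : g ^ 2 ∈ A := hker.1 (by rw [map_pow, hsq])
  -- `g` both inverts and centralizes `g ^ 2 ∈ A`.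
  have hg4 : g ^ 2 ^ 2 = 1 := by
    have h1 := hconj g hg _ hg2
    have h2 : g * g ^ 2 * g⁻¹ = g ^ 2 := by group
    rw [h2] at h1
    rw [show 2 ^ 2 = 2 + 2 from rfl, pow_add]
    nth_rewrite 1 [h1]
    exact inv_mul_cancel _
  refine ⟨A, g, ⟨e⟩, Set.eq_univ_of_forall fun h => ?_, ?_, hg2, fun a ha => ?_⟩
  · by_cases hh : h ∈ A
    · exact ⟨h, hh, 1, one_mem _, mul_one h⟩
    · refine ⟨h * g⁻¹, hker.1 ?_, g, Subgroup.mem_zpowers g, inv_mul_cancel_right h g⟩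
      rw [map_mul, map_inv, mul_inv_eq_one]
      ext1 x
      rw [hneg h hh, hneg g hg]
  · obtain ⟨k, hk, hk'⟩ := (Nat.dvd_prime_pow Nat.prime_two).1 (orderOf_dvd_of_pow_eq_one hg4)
    interval_cases k
    · exfalso
      rw [pow_zero, orderOf_eq_one_iff] at hk'
      exact hg (hk' ▸ one_mem A)
    · exact Or.inl hk'
    · exact Or.inr hk'
  · simpa using hconj g⁻¹ (fun h => hg (by simpa using A.inv_mem h)) a ha

end NormalPrufer

/-! ### The converse: each listed group is an 𝔛-group. -/

theorem isXGroup_of_isCyclic {G : Type*} [Group G] [IsCyclic G] : IsXGroup G :=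
  fun H hH => absurd (inferInstance : IsCyclic H) hH

theorem isXGroup_pruferGroup (p : ℕ) [Fact p.Prime] : IsXGroup (PruferGroup p) :=
  fun _ hH => PruferGroup.eq_top_of_not_isCyclic hH ▸ le_top

/-- A non-cyclic `H` contains a reflection and a non-trivial rotation. Only the trivial rotation
commutes with the former, and no reflection with the latter. -/
theorem isXGroup_dihedralGroup_zero : IsXGroup (DihedralGroup 0) := by
  intro H hH c hc
  rw [Subgroup.mem_centralizer_iff] at hc
  obtain ⟨i, hi⟩ : ∃ i, DihedralGroup.sr i ∈ H := by
    by_contra! h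
    refine hH (Subgroup.isCyclic_of_le (H' := Subgroup.zpowers (DihedralGroup.r 1)) ?_)
    rintro (k | k) hk
    · exact ⟨(show ℤ from k), 
        (DihedralGroup.r_one_zpow _).trans (congrArg DihedralGroup.r (Int.cast_id (n := k)))⟩
    · exact absurd hk (h k)
  obtain ⟨k, hk0, hk⟩ : ∃ k, k ≠ 0 ∧ DihedralGroup.r k ∈ H := by
    by_contra! h
    refine hH (Subgroup.isCyclic_of_le (H' := Subgroup.zpowers (DihedralGroup.sr i)) ?_)
    rintro (k | k) hk
    · have : k = 0 := by
        by_contra hne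
        exact h k hne hk
      rw [this, DihedralGroup.r_zero]
      exact one_mem _
    · have h1 : DihedralGroup.r (k - i) ∈ H := by
        rw [← DihedralGroup.sr_mul_sr]
        exact H.mul_mem hi hk
      have : k - i = 0 := by
        by_contra hne
        exact h _ hne h1
      rw [sub_eq_zero.1 this]
      exact Subgroup.mem_zpowers _
  rcases c with m | m
  · have h1 := hc _ hi
    rw [DihedralGroup.sr_mul_r, DihedralGroup.r_mul_sr, DihedralGroup.sr.injEq] at h1
    have h2 : m = 0 := by
      change (show ℤ from i) + (show ℤ from m) = (show ℤ from i) - (show ℤ from m) at h1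
      change (show ℤ from m) = 0
      omega
    rw [h2, DihedralGroup.r_zero]
    exact one_mem _
  · exfalso
    have h1 := hc _ hk
    rw [DihedralGroup.sr_mul_r, DihedralGroup.r_mul_sr, DihedralGroup.sr.injEq] at h1
    apply hk0
    change (show ℤ from m) - (show ℤ from k) = (show ℤ from m) + (show ℤ from k) at h1
    change (show ℤ from k) = 0
    omega

theorem isXGroup_of_inverting {G : Type*} [Group G] {A : Subgroup G} {y : G}
    (e : A ≃* PruferGroup 2) (hcov : (A : Set G) * (Subgroup.zpowers y : Set G) = Set.univ)
    (hy2 : y ^ 2 ∈ A) (hinv : ∀ a ∈ A, y⁻¹ * a * y = a⁻¹) : IsXGroup G := by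
  have hAc : ∀ a ∈ A, ∀ b ∈ A, a * b = b * a := fun a ha b hb => by
    have : (⟨a, ha⟩ : A) * ⟨b, hb⟩ = ⟨b, hb⟩ * ⟨a, ha⟩ :=
      e.injective (by rw [map_mul, map_mul, mul_comm])
    exact congrArg Subtype.val this
  have hyA : ∀ g, g ∉ A → g * y⁻¹ ∈ A := by
    intro g hg
    obtain ⟨a, ha, _, ⟨k, rfl⟩, rfl⟩ : g ∈ (A : Set G) * (Subgroup.zpowers y : Set G) :=
      hcov ▸ Set.mem_univ g
    rcases Int.even_or_odd' k with ⟨m, rfl | rfl⟩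
    · exfalso
      refine hg (A.mul_mem ha ?_)
      simp only
      rw [zpow_mul]
      exact A.zpow_mem (by exact_mod_cast hy2) m
    · simp only
      rw [zpow_add, zpow_one, mul_assoc, mul_inv_cancel_right, zpow_mul]
      exact A.mul_mem ha (A.zpow_mem (by exact_mod_cast hy2) m)
  have hdiv : ∀ u v, u ∉ A → v ∉ A → u * v⁻¹ ∈ A := by
    intro u v hu hv
    have := A.mul_mem (hyA u hu) (A.inv_mem (hyA v hv))
    simpa using this
  have hginv : ∀ g, g ∉ A → ∀ x ∈ A, g⁻¹ * x * g = x⁻¹ := by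
    intro g hg x hx
    have h1 := hyA g hg
    rw [← hinv x hx]
    have h2 : (g * y⁻¹)⁻¹ * x * (g * y⁻¹) = x := by
      rw [mul_assoc, hAc x hx _ h1, inv_mul_cancel_left]
    nth_rewrite 2 [← h2]
    group
  have hsq : ∀ c h, c ∈ A → h ∉ A → h * c = c * h → c ^ 2 = 1 := by
    intro c h hc hh hcomm
    have h1 := hginv h hh c hc
    rw [mul_assoc, ← hcomm, inv_mul_cancel_left] at h1
    rw [pow_two]
    exact eq_inv_iff_mul_eq_one.1 h1
  intro H hH c hc
  rw [Subgroup.mem_centralizer_iff] at hc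
  by_cases hHA : H ≤ A
  · have hAH : A ≤ H := by
      rw [← Subgroup.subgroupOf_eq_top]
      by_contra hne
      have hcyc : IsCyclic (H.subgroupOf A) := by
        by_contra h
        have h1 : ¬ IsCyclic ((H.subgroupOf A).map e.toMonoidHom) := fun h' => h
          (((H.subgroupOf A).equivMapOfInjective e.toMonoidHom e.injective).isCyclic.2 h')
        have h2 := PruferGroup.eq_top_of_not_isCyclic h1
        apply hne
        refine eq_top_iff.2 fun a _ => ?_
        obtain ⟨b, hb, hba⟩ := (h2 ▸ Subgroup.mem_top (e a) :
          e a ∈ (H.subgroupOf A).map e.toMonoidHom)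
        rwa [← e.injective hba]
      exact hH ((Subgroup.subgroupOfEquivOfLe hHA).isCyclic.1 hcyc)
    by_contra hcH
    have hcA : c ∉ A := fun h => hcH (hAH h)
    -- `x 1` has order `4`, so it cannot be centralized by `c`, which inverts `A`.
    obtain ⟨x, hx⟩ := PruferGroup.exists_chain 2
    have h1 := hsq (e.symm (x 1)) c (e.symm (x 1)).2 hcA (hc _ (hAH (e.symm (x 1)).2)).symm
    have h2 : x 1 ^ 2 = 1 := by
      rw [← e.apply_symm_apply (x 1), ← map_pow, ← map_one e]
      exact congrArg e (Subtype.ext h1)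
    have h3 := orderOf_dvd_of_pow_eq_one h2
    rw [hx.orderOf_eq] at h3
    norm_num at h3
  · obtain ⟨h, hhH, hhA⟩ := SetLike.not_le_iff_exists.1 hHA
    have hinter : ∃ b ∈ H, b ∈ A ∧ b ≠ 1 := by
      by_contra! hno
      refine hH (Subgroup.isCyclic_of_le (H' := Subgroup.zpowers h) fun k hk => ?_)
      by_cases hkA : k ∈ A
      · rw [hno k hk hkA]; exact one_mem _
      · have := hno _ (H.mul_mem hk (H.inv_mem hhH)) (hdiv k h hkA hhA)
        rw [mul_inv_eq_one.1 this]
        exact Subgroup.mem_zpowers h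
    obtain ⟨b, hbH, hbA, hb1⟩ := hinter
    -- Such a `d` satisfies `d ^ 2 = 1`, and `⟨b⟩`, being non-trivial, contains every such element
    -- of `A`.
    have key : ∀ d ∈ A, h * d = d * h → d ∈ H := by
      intro d hd hhd
      have h1 := hsq d h hd hhA hhd
      have h2 : e ⟨d, hd⟩ ∈ Subgroup.zpowers (e ⟨b, hbA⟩) := by
        refine PruferGroup.mem_zpowers_of_pow_orderOf (orderOf_dvd_iff_pow_eq_one.1 ?_)
        obtain ⟨k, hk⟩ := PruferGroup.exists_orderOf_eq (e ⟨b, hbA⟩)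
        have hk0 : k ≠ 0 := by
          rintro rfl
          rw [pow_zero, orderOf_eq_one_iff, map_eq_one_iff e e.injective] at hk
          exact hb1 (congrArg Subtype.val hk)
        rw [hk]
        refine (orderOf_dvd_of_pow_eq_one ?_).trans (dvd_pow_self 2 hk0)
        rw [← map_pow, ← map_one e]
        exact congrArg e (Subtype.ext h1)
      obtain ⟨k, hk⟩ := h2
      simp only [← map_zpow] at hk
      have h3 : b ^ k = d := congrArg Subtype.val (e.injective hk)
      exact h3 ▸ H.zpow_mem hbH k
    by_cases hcA : c ∈ A
    · exact key c hcA (hc h hhH)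
    · have h1 := key _ (hdiv c h hcA hhA) (by
        rw [← mul_assoc, hc h hhH]; group)
      simpa using H.mul_mem h1 hhH

/-- `D` acts without non-trivial fixed points, as in a Frobenius group. A non-cyclic `H` is either
the whole Prüfer factor or meets it non-trivially and also leaves it; in the latter case its
centralizer is trivial. -/
theorem isXGroup_semidirectProduct {p : ℕ} [hp : Fact p.Prime] (hodd : Odd p)
    {φ : MulAut (PruferGroup p)} {D : Subgroup (MulAut (PruferGroup p))}
    (hφ : orderOf φ = p - 1) (hD : D ≤ Subgroup.zpowers φ) :
    IsXGroup (PruferGroup p ⋊[D.subtype] D) := by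
  have hφfin : IsOfFinOrder φ := orderOf_pos_iff.1 (by
    have := hp.out.two_le
    omega)
  have hfree : ∀ (d : D) (x : PruferGroup p), x ≠ 1 → (d : MulAut (PruferGroup p)) x = x →
      d = 1 := by
    intro d x hx hdx
    obtain ⟨k, hk⟩ := hD d.2
    refine Subtype.ext (PruferGroup.eq_one_of_fix_ne_one hodd ?_ hx hdx)
    rw [← hk]
    exact hφfin.zpow
  have hDc : IsCyclic D := Subgroup.isCyclic_of_le hD
  intro H hH c hc
  rw [Subgroup.mem_centralizer_iff] at hc
  have hright : ∀ u : PruferGroup p, SemidirectProduct.inl u * c = c * SemidirectProduct.inl u →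
      (c.right : MulAut (PruferGroup p)) u = u := by
    intro u hu
    have h1 := congrArg SemidirectProduct.left hu
    simp only [SemidirectProduct.mul_left, SemidirectProduct.left_inl,
      SemidirectProduct.right_inl, map_one, MulAut.one_apply] at h1
    rw [mul_comm] at h1
    exact (mul_left_cancel h1).symm
  have heq : ∀ x : PruferGroup p ⋊[D.subtype] D, x.right = 1 → x = SemidirectProduct.inl x.left :=
    fun x hx => SemidirectProduct.ext rfl hx
  by_cases hall : ∀ h ∈ H, h.right = 1
  · have htop : H.comap (SemidirectProduct.inl) = ⊤ := by
      refine PruferGroup.eq_top_of_not_isCyclic fun hcyc => hH ?_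
      have h1 : (H.comap SemidirectProduct.inl).map SemidirectProduct.inl = H := by
        refine Subgroup.map_comap_eq_self fun h hh => ⟨h.left, (heq h (hall h hh)).symm⟩
      rw [← h1]
      exact (Subgroup.equivMapOfInjective _ _ SemidirectProduct.inl_injective).isCyclic.1 hcyc
    have hin : ∀ u, SemidirectProduct.inl u ∈ H := fun u =>
      (htop ▸ Subgroup.mem_top u : u ∈ H.comap SemidirectProduct.inl)
    have h1 : c.right = 1 := Subtype.ext (MulEquiv.ext fun u => hright u (hc _ (hin u)))
    rw [heq c h1]
    exact hin _
  · push Not at hall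
    obtain ⟨h, hhH, hh⟩ := hall
    obtain ⟨x, hxH, hx1, hx⟩ : ∃ x ∈ H, x ≠ 1 ∧ x.right = 1 := by
      by_contra! hno
      refine hH (isCyclic_of_injective (SemidirectProduct.rightHom.comp H.subtype) ?_)
      rw [injective_iff_map_eq_one]
      rintro ⟨x, hxH⟩ hx
      by_contra hne
      exact hno x hxH (fun h => hne (Subtype.ext h)) hx
    have hcr : c.right = 1 := by
      refine hfree _ x.left (fun h => hx1 (SemidirectProduct.ext h hx)) (hright _ ?_)
      rw [← heq x hx]
      exact hc x hxH
    have hcl : c.left = 1 := by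
      by_contra hne
      refine hh (hfree _ c.left hne ?_)
      have h1 := congrArg SemidirectProduct.left (hc h hhH)
      simp only [SemidirectProduct.mul_left, hcr, map_one, MulAut.one_apply] at h1
      rw [mul_comm c.left] at h1
      exact mul_left_cancel h1
    have : c = 1 := SemidirectProduct.ext hcl hcr
    exact this ▸ one_mem H

theorem mainTheorem3 (G : Type*) [Group G] [Infinite G] [Group.IsSolvable G] :
    IsXGroup G ↔
      IsCyclic G ∨
      (∃ p : ℕ, p.Prime ∧ Nonempty (G ≃* PruferGroup p)) ∨
      Nonempty (G ≃* DihedralGroup 0) ∨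
      (∃ (A : Subgroup G) (y : G),
        Nonempty (A ≃* PruferGroup 2) ∧
        (A : Set G) * (Subgroup.zpowers y : Set G) = Set.univ ∧
        (orderOf y = 2 ∨ orderOf y = 4) ∧
        y ^ 2 ∈ A ∧
        ∀ a ∈ A, y⁻¹ * a * y = a⁻¹) ∨
      (∃ p : ℕ, p.Prime ∧ Odd p ∧
        ∃ (φ : MulAut (PruferGroup p)) (D : Subgroup (MulAut (PruferGroup p))),
          orderOf φ = p - 1 ∧ D ≤ Subgroup.zpowers φ ∧ D ≠ ⊥ ∧
          Nonempty (G ≃* PruferGroup p ⋊[D.subtype] D)) := by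
  constructor
  · intro hG
    obtain ⟨A, hAn, hAi, hAc⟩ := hG.exists_infinite_normal_comm
    rcases (hG.subgroup A).isCyclic_or_pruferGroup
      (fun a b => Subtype.ext (hAc a a.2 b b.2)) with hc | ⟨p, hp, ⟨e⟩⟩
    · rcases hG.cyclic_or_dihedral hAn hAi hc with h | h
      · exact Or.inl h
      · exact Or.inr (Or.inr (Or.inl h))
    · have := Fact.mk hp
      rcases hp.eq_two_or_odd' with rfl | hodd
      · rcases hG.mulEquiv_or_inverting e with h | h
        · exact Or.inr (Or.inl ⟨2, hp, h⟩)
        · exact Or.inr (Or.inr (Or.inr (Or.inl h)))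
      · rcases hG.mulEquiv_or_semidirectProduct hodd e with h | h
        · exact Or.inr (Or.inl ⟨p, hp, h⟩)
        · exact Or.inr (Or.inr (Or.inr (Or.inr ⟨p, hp, hodd, h⟩)))
  · rintro (h | ⟨p, hp, ⟨e⟩⟩ | ⟨⟨e⟩⟩ | ⟨A, y, ⟨e⟩, hcov, -, hy2, hinv⟩ |
      ⟨p, hp, hodd, φ, D, hφ, hD, -, ⟨e⟩⟩)
    · exact isXGroup_of_isCyclic
    · have := Fact.mk hp
      exact (isXGroup_pruferGroup p).of_mulEquiv e
    · exact isXGroup_dihedralGroup_zero.of_mulEquiv e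
    · exact isXGroup_of_inverting e hcov hy2 hinv
    · have := Fact.mk hp
      exact (isXGroup_semidirectProduct hodd hφ hD).of_mulEquiv e
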